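/- Let $m\ge 1$ be an integer and $\mathcal X$ a measurable space. For every $n\ge 1$ let $X_{n,1},\dots,X_{n,n}$ be independent $\mathcal X$-valued random variables (defined on a probability space that may depend on $n$), with laws $P_{n,1},\dots,P_{n,n}$ that need not be equal; let $a_n:[n]^m\to\mathbb R$ be a weight function and $h_n:\mathcal X^m\to\mathbb R$ a measurable kernel, neither of which is assumed symmetric. We drop the index $n$ and write $[n]=\{1,\dots,n\}$. Let $I_n^m$ be the set of $m$-tuples of pairwise distinct elements of $[n]$ and, for $n\ge m$, $$U_n=\frac{(n-m)!}{n!}\sum_{(i_1,\dots,i_m)\in I_n^m}a(i_1,\dots,i_m)\,h(X_{i_1},\dots,X_{i_m}).$$ For $l\in[m]$ let $\pi_l(y;y_1,\dots,y_{m-1})=(y_1,\dots,y_{l-1},y,y_l,\dots,y_{m-1})$. Put $$\theta(i_1,\dots,i_m)=\int h(y_1,\dots,y_m)\,dP_{i_1}(y_1)\cdots dP_{i_m}(y_m),$$ $$f^{(l)}_{i_1,\dots,i_{m-1}}(x)=\int h(\pi_l(x;y_1,\dots,y_{m-1}))\,dP_{i_1}(y_1)\cdots dP_{i_{m-1}}(y_{m-1}),$$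 $$h_{1,i}(x)=\frac{(n-m)!}{(n-1)!}\sum\;\sum_{l=1}^m a(\pi_l(i;i_1,\dots,i_{m-1}))\big\{f^{(l)}_{i_1,\dots,i_{m-1}}(x)-\theta(\pi_l(i;i_1,\dots,i_{m-1}))\big\},$$ where the outer sum in the last line is over all $(m-1)$-tuples $(i_1,\dots,i_{m-1})$ of pairwise distinct elements of $[n]\setminus\{i\}$. Let $$V(n)=\mathrm{Var}\Big(\frac1n\sum_{i=1}^n h_{1,i}(X_i)\Big).$$ For integers $K\ge 2$ and $q\ge 0$ let $(I_n^m)^{\otimes K}_{\ge q}$ be the set of all $K$-tuples $(\mathbf i^{(1)},\dots,\mathbf i^{(K)})$ of elements of $I_n^m$ such that at least $q$ elements of $[n]$ occur as entries of every one of $\mathbf i^{(1)},\dots,\mathbf i^{(K)}$, and let $$A_{K,q}(n)=\frac{1}{\mathrm{card}\{(I_n^m)^{\otimes K}_{\ge q}\}}\sum_{(\mathbf i^{(1)},\dots,\mathbf i^{(K)})\in (I_n^m)^{\otimes K}_{\ge q}}\big|a(\mathbf i^{(1)})\cdots a(\mathbf i^{(K)})\big|,$$ read as $0$ if this set is empty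 (as it is for $m=1$, $q=2$). **Theorem (sufficient condition for asymptotic normality of $U_n$).** For each $n$ let $M(n)>0$ be a constant with $$\max_{(i_1,\dots,i_m)\in I_n^m}E\{h(X_{i_1},\dots,X_{i_m})^4\}\le M(n).$$ Assume that $V(n)>0$ for all sufficiently large $n$ and that, as $n\to\infty$, $$n^{-2}V(n)^{-1}A_{2,2}(n)M(n)^{1/2}\to0\qquad\text{and}\qquad n^{-2}V(n)^{-3/2}A_{3,1}(n)M(n)^{3/4}\to0.$$ Then $$\mathrm{Var}(U_n)/V(n)\to1\qquad\text{and}\qquad \mathrm{Var}(U_n)^{-1/2}\{U_n-E(U_n)\}\xrightarrow{d}N(0,1).$$ -/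

import Mathlib

open MeasureTheory ProbabilityTheory Filter Topology

noncomputable section

namespace WeightedU

/-- `I_n^m`: the `m`-tuples of pairwise distinct indices (indices run over `Fin n`). -/
def indexSet (n m : ℕ) : Finset (Fin m → Fin n) :=
  Finset.univ.filter fun t => Function.Injective t

/-- `I_{n-1}^{k}(-i)`: the `k`-tuples of pairwise distinct indices, all different from `i`. -/
def indexSetExcept (n k : ℕ) (i : Fin n) : Finset (Fin k → Fin n) :=
  Finset.univ.filter fun t => Function.Injective t ∧ ∀ j, t j ≠ i

/-- The indices that occur in every one of the tuples `t 0, …, t (K - 1)`. -/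
def commonIndices {n m K : ℕ} (t : Fin K → Fin m → Fin n) : Finset (Fin n) :=
  Finset.univ.filter fun i => ∀ k, ∃ j, t k j = i

/-- `(I_n^m)_{≥ q}^{⊗ K}`: the `K`-tuples of elements of `I_n^m` that share at least `q` indices. -/
def sharingSet (n m K q : ℕ) : Finset (Fin K → Fin m → Fin n) :=
  Finset.univ.filter fun t => (∀ k, t k ∈ indexSet n m) ∧ q ≤ (commonIndices t).card

/-- The average weight `A_{K,q}(n)` of a weight function `a`. -/
def avgWeight {n m : ℕ} (a : (Fin m → Fin n) → ℝ) (K q : ℕ) : ℝ :=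
  ((sharingSet n m K q).card : ℝ)⁻¹ * ∑ t ∈ sharingSet n m K q, |∏ k, a (t k)|

variable {𝓧 : Type*}

/-- The weighted U-statistic of degree `m` evaluated at the sample `x`. -/
def uStat {n m : ℕ} (a : (Fin m → Fin n) → ℝ) (h : (Fin m → 𝓧) → ℝ) (x : Fin n → 𝓧) : ℝ :=
  ((n - m).factorial : ℝ) / (n.factorial : ℝ) *
    ∑ t ∈ indexSet n m, a t * h fun j => x (t j)

variable [MeasurableSpace 𝓧]

/-- `θ(i_1, …, i_m) = ∫ h(y_1, …, y_m) dP_{i_1}(y_1) ⋯ dP_{i_m}(y_m)`. -/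
def theta {n m : ℕ} (h : (Fin m → 𝓧) → ℝ) (P : Fin n → Measure 𝓧) (t : Fin m → Fin n) : ℝ :=
  ∫ y, h y ∂(Measure.pi fun j => P (t j))

/-- `f^{(l)}_{i_1, …, i_{m-1}}(x)`, with `m = k + 1`: the integral of `h` over all arguments but
the `l`-th one, which is set to `x`. -/
def proj {n k : ℕ} (h : (Fin (k + 1) → 𝓧) → ℝ) (P : Fin n → Measure 𝓧) (l : Fin (k + 1))
    (t : Fin k → Fin n) (x : 𝓧) : ℝ :=
  ∫ y : Fin k → 𝓧, h (l.insertNth x y) ∂(Measure.pi fun j => P (t j))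

/-- `h_{1,i;i_1, …, i_{m-1}}(x)`, with `m = k + 1`. -/
def firstOrderAt {n k : ℕ} (a : (Fin (k + 1) → Fin n) → ℝ) (h : (Fin (k + 1) → 𝓧) → ℝ)
    (P : Fin n → Measure 𝓧) (i : Fin n) (t : Fin k → Fin n) (x : 𝓧) : ℝ :=
  ∑ l : Fin (k + 1), a (l.insertNth i t) * (proj h P l t x - theta h P (l.insertNth i t))

/-- `h_{1,i}(x)`, with `m = k + 1`: the first order expansion of `h` for the `i`-th variable. -/
def firstOrder {n k : ℕ} (a : (Fin (k + 1) → Fin n) → ℝ) (h : (Fin (k + 1) → 𝓧) → ℝ)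
    (P : Fin n → Measure 𝓧) (i : Fin n) (x : 𝓧) : ℝ :=
  ((n - (k + 1)).factorial : ℝ) / ((n - 1).factorial : ℝ) *
    ∑ t ∈ indexSetExcept n k i, firstOrderAt a h P i t x

/-- `V(n) = Var(n⁻¹ ∑ i, h_{1,i}(X_i))`, where `P_i` is the law of `X_i`. -/
def mainVar {Ω : Type*} [MeasurableSpace Ω] {n k : ℕ} (a : (Fin (k + 1) → Fin n) → ℝ)
    (h : (Fin (k + 1) → 𝓧) → ℝ) (μ : Measure Ω) (X : Fin n → Ω → 𝓧) : ℝ :=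
  variance (fun ω => (n : ℝ)⁻¹ * ∑ i, firstOrder a h (fun j => μ.map (X j)) i (X i ω)) μ

end WeightedU

end

/-! The limit is carried by the Hájek projection. On each index tuple the kernel splits into its
mean, its centred one-variable projections and a residual (`uStat_eq`). Hence `U_n - E U_n = S + D`,
where `S` (`linearPart`) is a sum of independent centred terms with variance `V` and `D`
(`remainder`) collects the residuals.

Freezing all variables except those of a tuple, and at most one of these, leaves a residual of mean
zero (`integral_residual_mul_eq_zero`). So `D` is orthogonal to `S`, which gives `Var U_n = V + E
D²` (`variance_uStat`), and in `E D²` only pairs of tuples sharing at least two indices survive.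
There are `O(n^(2m-2))` of them against a squared normalizer of order `n^(-2m)`, whence `E D² =
O(n⁻² A_{2,2} M^(1/2))` (`integral_sq_remainder_le_rate`). The first assumption makes this `o(V)`.

For `S` Lyapunov's condition is checked: the sum of third absolute moments expands over triples of
tuples with a common index, again a fraction `O(n⁻²)` of all triples, and is `O(n⁻² A_{3,1}
M^(3/4))` (`sum_integral_abs_cube_le_rate`). The second assumption makes this `o(V^(3/2))`.

Convergence is proved with characteristic functions. `norm_charFun_sum_sub_gaussian_le` compares `S
/ √V` with the Gaussian, `norm_charFun_map_sub_le` passes from `S / √V` to the standardized `U_n`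
through their L¹ distance, and Lévy's continuity theorem concludes. -/

/-! ### Characteristic functions and a quantitative Lyapunov theorem. -/

theorem norm_prod_sub_prod_le_sum {ι : Type*} (s : Finset ι) (f g : ι → ℂ)
    (hf : ∀ i, ‖f i‖ ≤ 1) (hg : ∀ i, ‖g i‖ ≤ 1) :
    ‖∏ i ∈ s, f i - ∏ i ∈ s, g i‖ ≤ ∑ i ∈ s, ‖f i - g i‖ := by
  classical
  induction s using Finset.induction_on with
  | empty => simp
  | insert a s ha ih =>
    rw [Finset.prod_insert ha, Finset.prod_insert ha, Finset.sum_insert ha]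
    have hP : ‖∏ i ∈ s, f i‖ ≤ 1 := by
      rw [norm_prod]
      exact Finset.prod_le_one (fun i _ => norm_nonneg _) fun i _ => hf i
    have : f a * ∏ i ∈ s, f i - g a * ∏ i ∈ s, g i
        = (f a - g a) * ∏ i ∈ s, f i + g a * (∏ i ∈ s, f i - ∏ i ∈ s, g i) := by ring
    rw [this]
    refine (norm_add_le _ _).trans ?_
    rw [norm_mul, norm_mul]
    refine add_le_add ?_ ?_
    · exact mul_le_of_le_one_right (norm_nonneg _) hP
    · exact (mul_le_of_le_one_left (norm_nonneg _) (hg a)).trans ih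

/-- For `|x| ≤ 1` this is the Taylor remainder, with constant 2/9. For `|x| ≥ 1` no cancellation is
needed: the triangle inequality gives at most `2 + |x| + |x|²/2 ≤ 4 |x|³`. -/
theorem norm_cexp_mul_I_sub_taylor_le (x : ℝ) :
    ‖Complex.exp (x * Complex.I) - (1 + x * Complex.I - (x : ℂ) ^ 2 / 2)‖ ≤ 4 * |x| ^ 3 := by
  have hn : ‖(x : ℂ) * Complex.I‖ = |x| := by simp
  rcases le_total |x| 1 with hx | hx
  · have h := Complex.exp_bound (x := x * Complex.I) (hn.le.trans hx) (n := 3) (by norm_num)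
    have hs : ∑ m ∈ Finset.range 3, ((x : ℂ) * Complex.I) ^ m / (m.factorial : ℂ)
        = 1 + x * Complex.I - (x : ℂ) ^ 2 / 2 := by
      simp [Finset.sum_range_succ, Nat.factorial, mul_pow]
      ring
    rw [hs, hn] at h
    refine h.trans ?_
    have : (0 : ℝ) ≤ |x| ^ 3 := by positivity
    norm_num [Nat.factorial]
    nlinarith
  · have h1 : ‖Complex.exp (x * Complex.I)‖ = 1 := Complex.norm_exp_ofReal_mul_I x
    have h2 : ‖(1 + x * Complex.I - (x : ℂ) ^ 2 / 2)‖ ≤ 1 + |x| + |x| ^ 2 / 2 := by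
      refine (norm_sub_le _ _).trans (add_le_add ((norm_add_le _ _).trans ?_) ?_)
      · simp
      · simp
    refine (norm_sub_le _ _).trans ?_
    rw [h1]
    have h3 : |x| ≤ |x| ^ 2 := by nlinarith
    have h4 : |x| ^ 2 ≤ |x| ^ 3 := by nlinarith
    linarith

theorem abs_exp_neg_sub_one_sub_le {x : ℝ} (hx : 0 ≤ x) :
    |(1 - x) - Real.exp (-x)| ≤ x ^ 2 := by
  have h1 : 1 - x ≤ Real.exp (-x) := by linarith [Real.add_one_le_exp (-x)]
  have h2 : Real.exp (-x) ≤ 1 - x + x ^ 2 := by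
    rw [Real.exp_neg, inv_le_comm₀ (Real.exp_pos _) (by nlinarith [sq_nonneg (x - 1)])]
    refine le_trans ?_ (Real.add_one_le_exp x)
    rw [inv_le_iff_one_le_mul₀ (by nlinarith [sq_nonneg (x - 1)])]
    -- The product is `(1 - x + x²)(1 + x) = 1 + x³`.
    nlinarith [pow_nonneg hx 3]
  rw [abs_le]
  constructor <;> nlinarith [sq_nonneg x]

section Moments

variable {Ω : Type*} [MeasurableSpace Ω] {μ : Measure Ω}

theorem integrable_abs_pow_of_memLp {f : Ω → ℝ} {p : ℕ} (hp : p ≠ 0) (hf : MemLp f p μ) :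
    Integrable (fun ω => |f ω| ^ p) μ := by
  simpa using hf.integrable_norm_pow hp

variable [IsProbabilityMeasure μ]

/-- With `s² = E f²`, integrating `3 s y² ≤ 2 y³ + s³` at `y = |f|` gives `s³ ≤ E|f|³`, and `s ≤ 1`
lowers the left side to `s⁴`. This absorbs the squared-variance error of replacing `1 - x` by `exp
(-x)` into the third moment. -/
theorem sq_integral_sq_le_integral_abs_cube {f : Ω → ℝ} (hf : MemLp f 3 μ)
    (h1 : ∫ ω, f ω ^ 2 ∂μ ≤ 1) :
    (∫ ω, f ω ^ 2 ∂μ) ^ 2 ≤ ∫ ω, |f ω| ^ 3 ∂μ := by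
  set v := ∫ ω, f ω ^ 2 ∂μ with hv
  have hv0 : 0 ≤ v := integral_nonneg fun ω => sq_nonneg _
  have hf2 : Integrable (fun ω => f ω ^ 2) μ :=
    (hf.mono_exponent (by norm_num : (2 : ENNReal) ≤ 3)).integrable_sq
  have hf3 : Integrable (fun ω => |f ω| ^ 3) μ :=
    integrable_abs_pow_of_memLp (p := 3) (by norm_num) (by simpa using hf)
  have h3 : 0 ≤ ∫ ω, |f ω| ^ 3 ∂μ := integral_nonneg fun ω => by positivity
  set s := Real.sqrt v with hs
  have hs0 : 0 ≤ s := Real.sqrt_nonneg _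
  have hsv : s ^ 2 = v := Real.sq_sqrt hv0
  have hs1 : s ≤ 1 := by rw [hs]; exact Real.sqrt_le_one.mpr h1
  have key : ∫ ω, 3 * s * f ω ^ 2 ∂μ ≤ ∫ ω, (2 * |f ω| ^ 3 + s ^ 3) ∂μ := by
    refine integral_mono (hf2.const_mul _) ((hf3.const_mul _).add (integrable_const _)) fun ω => ?_
    have : 0 ≤ |f ω| := abs_nonneg _
    change 3 * s * f ω ^ 2 ≤ 2 * |f ω| ^ 3 + s ^ 3
    rw [← sq_abs]
    -- The difference of the two sides is `(|f| - s)² (2|f| + s)`.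
    nlinarith [mul_nonneg (sq_nonneg (|f ω| - s)) (by linarith : 0 ≤ 2 * |f ω| + s)]
  rw [integral_const_mul, integral_add (hf3.const_mul _) (integrable_const _),
    integral_const_mul, integral_const, ← hv] at key
  simp only [probReal_univ, one_smul] at key
  rw [← hsv] at key ⊢
  have : s ^ 4 ≤ s ^ 3 := pow_le_pow_of_le_one hs0 hs1 (by norm_num)
  nlinarith

/-- Both terms are compared with `1 - v t² / 2`: the characteristic function by Taylor expansion
under the integral, the exponential by its own second-order error. -/
theorem norm_charFun_sub_exp_le {f : Ω → ℝ} (hfm : Measurable f) (hf : MemLp f 3 μ)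
    (h0 : ∫ ω, f ω ∂μ = 0) (h1 : ∫ ω, f ω ^ 2 ∂μ ≤ 1) (t : ℝ) :
    ‖charFun (μ.map f) t - Real.exp (-((∫ ω, f ω ^ 2 ∂μ) * t ^ 2 / 2))‖
      ≤ (4 * |t| ^ 3 + t ^ 4) * ∫ ω, |f ω| ^ 3 ∂μ := by
  have hfi : Integrable f μ := hf.integrable (by norm_num)
  have hf2 : Integrable (fun ω => f ω ^ 2) μ :=
    (hf.mono_exponent (by norm_num : (2 : ENNReal) ≤ 3)).integrable_sq
  have hf3 : Integrable (fun ω => |f ω| ^ 3) μ :=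
    integrable_abs_pow_of_memLp (p := 3) (by norm_num) (by simpa using hf)
  have h3 : 0 ≤ ∫ ω, |f ω| ^ 3 ∂μ := integral_nonneg fun ω => by positivity
  have hv0 : 0 ≤ ∫ ω, f ω ^ 2 ∂μ := integral_nonneg fun ω => sq_nonneg _
  have hsq := sq_integral_sq_le_integral_abs_cube hf h1
  set v := ∫ ω, f ω ^ 2 ∂μ with hv
  have hcf : charFun (μ.map f) t = ∫ ω, Complex.exp ((t * f ω : ℝ) * Complex.I) ∂μ := by
    rw [charFun_apply_real, integral_map hfm.aemeasurable (by fun_prop)]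
    push_cast
    rfl
  have hei : Integrable (fun ω => Complex.exp ((t * f ω : ℝ) * Complex.I)) μ := by
    refine Integrable.of_bound (C := 1) (by fun_prop) (Eventually.of_forall fun ω => ?_)
    rw [Complex.norm_exp_ofReal_mul_I]
  have hT : ∀ ω, (1 + ((t * f ω : ℝ) : ℂ) * Complex.I - ((t * f ω : ℝ) : ℂ) ^ 2 / 2)
      = 1 + (t * Complex.I) * ((f ω : ℝ) : ℂ) - ((t : ℂ) ^ 2 / 2) * ((f ω ^ 2 : ℝ) : ℂ) := by
    intro ω; push_cast; ring
  have hiA : Integrable (fun ω => (t * Complex.I) * ((f ω : ℝ) : ℂ)) μ := hfi.ofReal.const_mul _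
  have hiB : Integrable (fun ω => ((t : ℂ) ^ 2 / 2) * ((f ω ^ 2 : ℝ) : ℂ)) μ :=
    hf2.ofReal.const_mul _
  have hi1 : Integrable (fun _ : Ω => (1 : ℂ)) μ := integrable_const _
  have hTi : Integrable (fun ω => (1 + ((t * f ω : ℝ) : ℂ) * Complex.I
      - ((t * f ω : ℝ) : ℂ) ^ 2 / 2)) μ := by
    simp_rw [hT]
    exact (hi1.add hiA).sub hiB
  have hTe : ∫ ω, (1 + ((t * f ω : ℝ) : ℂ) * Complex.I - ((t * f ω : ℝ) : ℂ) ^ 2 / 2) ∂μ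
      = ((1 - v * t ^ 2 / 2 : ℝ) : ℂ) := by
    simp_rw [hT]
    have hi1A : Integrable (fun ω => 1 + (t * Complex.I) * ((f ω : ℝ) : ℂ)) μ := hi1.add hiA
    rw [integral_sub hi1A hiB, integral_add hi1 hiA, integral_const_mul,
      integral_const_mul, integral_complex_ofReal, integral_complex_ofReal, h0, ← hv]
    simp
    ring
  have hA : ‖charFun (μ.map f) t - ((1 - v * t ^ 2 / 2 : ℝ) : ℂ)‖
      ≤ 4 * |t| ^ 3 * ∫ ω, |f ω| ^ 3 ∂μ := by
    rw [hcf, ← hTe, ← integral_sub hei hTi, ← integral_const_mul]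
    refine (norm_integral_le_integral_norm _).trans ?_
    refine integral_mono (hei.sub hTi).norm (hf3.const_mul _) fun ω => ?_
    refine (norm_cexp_mul_I_sub_taylor_le _).trans ?_
    rw [abs_mul, mul_pow, mul_assoc]
  have hB : ‖((1 - v * t ^ 2 / 2 : ℝ) : ℂ) - (Real.exp (-(v * t ^ 2 / 2)) : ℂ)‖
      ≤ t ^ 4 * ∫ ω, |f ω| ^ 3 ∂μ := by
    rw [← Complex.ofReal_sub, Complex.norm_real, Real.norm_eq_abs]
    refine (abs_exp_neg_sub_one_sub_le (by positivity)).trans ?_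
    have : (v * t ^ 2 / 2) ^ 2 = t ^ 4 * v ^ 2 / 4 := by ring
    rw [this]
    have h4 : 0 ≤ t ^ 4 := by positivity
    nlinarith [mul_le_mul_of_nonneg_left hsq h4, mul_nonneg h4 (sq_nonneg v)]
  calc _ ≤ _ := norm_sub_le_norm_sub_add_norm_sub _ ((1 - v * t ^ 2 / 2 : ℝ) : ℂ) _
    _ ≤ _ := by rw [add_mul]; exact add_le_add hA hB

/-- A quantitative Lyapunov central limit theorem, in terms of characteristic functions. -/
theorem norm_charFun_sum_sub_gaussian_le {ι : Type*} [Fintype ι] {f : ι → Ω → ℝ}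
    (hfm : ∀ i, Measurable (f i)) (hf : ∀ i, MemLp (f i) 3 μ) (hind : iIndepFun f μ)
    (h0 : ∀ i, ∫ ω, f i ω ∂μ = 0) (h1 : ∑ i, ∫ ω, f i ω ^ 2 ∂μ = 1) (t : ℝ) :
    ‖charFun (μ.map fun ω => ∑ i, f i ω) t - charFun (gaussianReal 0 1) t‖
      ≤ (4 * |t| ^ 3 + t ^ 4) * ∑ i, ∫ ω, |f i ω| ^ 3 ∂μ := by
  have hnn : ∀ i, 0 ≤ ∫ ω, f i ω ^ 2 ∂μ := fun i => integral_nonneg fun ω => sq_nonneg _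
  have hle : ∀ i, ∫ ω, f i ω ^ 2 ∂μ ≤ 1 := fun i => by
    rw [← h1]
    exact Finset.single_le_sum (f := fun i => ∫ ω, f i ω ^ 2 ∂μ) (fun j _ => hnn j)
      (Finset.mem_univ i)
  -- Because the variances add up to one, the standard Gaussian characteristic function factors over
  -- `ι`, and the two products can be compared factor by factor.
  have hg : charFun (gaussianReal 0 1) t
      = ∏ i, (Real.exp (-((∫ ω, f i ω ^ 2 ∂μ) * t ^ 2 / 2)) : ℂ) := by
    rw [charFun_gaussianReal, ← Complex.ofReal_prod, ← Real.exp_sum]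
    have : ∑ i, -((∫ ω, f i ω ^ 2 ∂μ) * t ^ 2 / 2) = - (t ^ 2 / 2) := by
      rw [Finset.sum_neg_distrib, ← Finset.sum_div, ← Finset.sum_mul, h1, one_mul]
    rw [this]
    simp
  rw [hind.charFun_map_fun_sum_eq_prod (fun i => (hfm i).aemeasurable), hg, Finset.prod_apply,
    Finset.mul_sum]
  refine (norm_prod_sub_prod_le_sum _ _ _ (fun i => ?_) fun i => ?_).trans
    (Finset.sum_le_sum fun i _ => norm_charFun_sub_exp_le (hfm i) (hf i) (h0 i) (hle i) t)
  · have := Measure.isProbabilityMeasure_map (μ := μ) (hfm i).aemeasurable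
    exact norm_charFun_le_one t
  · rw [Complex.norm_real, Real.norm_eq_abs, abs_of_pos (Real.exp_pos _), Real.exp_le_one_iff]
    have := hnn i
    have : 0 ≤ (∫ ω, f i ω ^ 2 ∂μ) * t ^ 2 / 2 := by positivity
    linarith

/-- The map `x ↦ exp (i t x)` is `|t|`-Lipschitz. This plays the part of Slutsky's lemma when the
remainder is discarded. -/
theorem norm_charFun_map_sub_le {f g : Ω → ℝ} (hfm : Measurable f) (hgm : Measurable g)
    (hf : Integrable f μ) (hg : Integrable g μ) (t : ℝ) :
    ‖charFun (μ.map f) t - charFun (μ.map g) t‖ ≤ |t| * ∫ ω, |f ω - g ω| ∂μ := by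
  have hcf : ∀ u : Ω → ℝ, Measurable u →
      charFun (μ.map u) t = ∫ ω, Complex.exp ((t * u ω : ℝ) * Complex.I) ∂μ ∧
      Integrable (fun ω => Complex.exp ((t * u ω : ℝ) * Complex.I)) μ := by
    intro u hu
    constructor
    · rw [charFun_apply_real, integral_map hu.aemeasurable (by fun_prop)]
      push_cast
      rfl
    · refine Integrable.of_bound (C := 1) (by fun_prop) (Eventually.of_forall fun ω => ?_)
      rw [Complex.norm_exp_ofReal_mul_I]
  rw [(hcf f hfm).1, (hcf g hgm).1, ← integral_sub (hcf f hfm).2 (hcf g hgm).2,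
    ← integral_const_mul]
  refine (norm_integral_le_integral_norm _).trans ?_
  refine integral_mono ((hcf f hfm).2.sub (hcf g hgm).2).norm ((hf.sub hg).abs.const_mul _)
    fun ω => ?_
  have : Complex.exp ((t * f ω : ℝ) * Complex.I) - Complex.exp ((t * g ω : ℝ) * Complex.I)
      = Complex.exp ((t * g ω : ℝ) * Complex.I) *
        (Complex.exp (Complex.I * (t * (f ω - g ω) : ℝ)) - 1) := by
    rw [mul_sub, ← Complex.exp_add]
    push_cast
    ring_nf
  change ‖_ - _‖ ≤ _
  rw [this, norm_mul, Complex.norm_exp_ofReal_mul_I, one_mul]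
  refine (Real.norm_exp_I_mul_ofReal_sub_one_le).trans ?_
  simp

end Moments

/-! ### Counting tuples with shared indices, and the normalizing factor. -/

namespace WeightedU

/-- Functions subject to two independent coincidence constraints make up at most a fraction
`n⁻²` of all functions. -/
theorem card_coincidence_le {β : Type*} [Fintype β] [DecidableEq β] {n : ℕ} {p q p' q' : β}
    (hpq : p ≠ q) (hp : p' ≠ p) (hp2 : p' ≠ q) (hq : q' ≠ p) (hq2 : q' ≠ q) :
    n ^ 2 * (Finset.univ.filter fun f : β → Fin n => f p = f p' ∧ f q = f q').card
      ≤ n ^ Fintype.card β := by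
  have hc : (Finset.univ : Finset (β → Fin n)).card = n ^ Fintype.card β := by simp
  have hd : n ^ 2 * (Finset.univ.filter fun f : β → Fin n => f p = f p' ∧ f q = f q').card
      = ((Finset.univ : Finset (Fin n × Fin n)) ×ˢ
        (Finset.univ.filter fun f : β → Fin n => f p = f p' ∧ f q = f q')).card := by
    rw [Finset.card_product]; simp [sq]
  rw [hd, ← hc]
  -- A constrained `f` is determined by its values off `p` and `q`, so these two values can be
  -- overwritten by an arbitrary pair without losing information.
  refine Finset.card_le_card_of_injOn
    (fun x => Function.update (Function.update x.2 p x.1.1) q x.1.2) (fun _ _ => by simp) ?_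
  rintro ⟨⟨i, j⟩, f⟩ hf ⟨⟨i', j'⟩, g⟩ hg h
  simp only [Finset.coe_product, Set.mem_prod, Finset.coe_filter, Set.mem_ofPred_eq,
    Finset.mem_univ, true_and] at hf hg
  have hx : ∀ b, Function.update (Function.update f p i) q j b
      = Function.update (Function.update g p i') q j' b := fun b => congrFun h b
  have hj : j = j' := by simpa using hx q
  have hi : i = i' := by simpa [hpq] using hx p
  have ho : ∀ b, b ≠ p → b ≠ q → f b = g b := fun b h1 h2 => by simpa [h1, h2] using hx b
  have hfg : f = g := by
    funext b
    by_cases h1 : b = p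
    · rw [h1, hf.2.1, hg.2.1]; exact ho _ hp hp2
    · by_cases h2 : b = q
      · rw [h2, hf.2.2, hg.2.2]; exact ho _ hq hq2
      · exact ho b h1 h2
  rw [hi, hj, hfg]

/-- A family of tuples is one function on `Fin K × Fin m`. A union bound over the at most `(K m)⁴`
choices of positions reduces to `card_coincidence_le`. -/
theorem sq_mul_card_le_of_coincidence {n m K : ℕ} (T : Finset (Fin K → Fin m → Fin n))
    (hT : ∀ t ∈ T, ∃ p q p' q' : Fin K × Fin m, p ≠ q ∧ p' ≠ p ∧ p' ≠ q ∧ q' ≠ p ∧ q' ≠ q ∧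
      t p.1 p.2 = t p'.1 p'.2 ∧ t q.1 q.2 = t q'.1 q'.2) :
    n ^ 2 * T.card ≤ (K * m) ^ 4 * n ^ (K * m) := by
  classical
  let β := Fin K × Fin m
  let Q : Finset (β × β × β × β) := Finset.univ.filter fun x =>
    x.1 ≠ x.2.1 ∧ x.2.2.1 ≠ x.1 ∧ x.2.2.1 ≠ x.2.1 ∧ x.2.2.2 ≠ x.1 ∧ x.2.2.2 ≠ x.2.1
  let F : β × β × β × β → Finset (β → Fin n) := fun x =>
    Finset.univ.filter fun f => f x.1 = f x.2.2.1 ∧ f x.2.1 = f x.2.2.2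
  have hQ : Q.card ≤ (K * m) ^ 4 := by
    refine (Finset.card_le_univ Q).trans (le_of_eq ?_)
    simp only [β, Fintype.card_prod, Fintype.card_fin]
    ring
  have hTc : T.card ≤ (Q.biUnion F).card := by
    refine Finset.card_le_card_of_injOn (fun t x => t x.1 x.2) ?_ ?_
    · intro t ht
      obtain ⟨p, q, p', q', h1, h2, h3, h4, h5, h6, h7⟩ := hT t ht
      refine Finset.mem_coe.mpr (Finset.mem_biUnion.mpr ⟨(p, q, p', q'), ?_, ?_⟩)
      · simp [Q, h1, h2, h3, h4, h5]
      · simp [F, h6, h7]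
    · intro t _ s _ h
      funext i j
      exact congrFun h (i, j)
  calc n ^ 2 * T.card ≤ n ^ 2 * ∑ x ∈ Q, (F x).card :=
        Nat.mul_le_mul_left _ (hTc.trans Finset.card_biUnion_le)
    _ = ∑ x ∈ Q, n ^ 2 * (F x).card := Finset.mul_sum _ _ _
    _ ≤ ∑ _x ∈ Q, n ^ (K * m) := by
        refine Finset.sum_le_sum fun x hx => ?_
        simp only [Q, Finset.mem_filter, Finset.mem_univ, true_and] at hx
        have := card_coincidence_le (n := n) hx.1 hx.2.1 hx.2.2.1 hx.2.2.2.1 hx.2.2.2.2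
        simpa [β] using this
    _ = Q.card * n ^ (K * m) := by simp
    _ ≤ _ := Nat.mul_le_mul_right _ hQ

/-- Two shared indices force two entries of the second tuple to repeat entries of the first. -/
theorem sq_mul_card_sharingSet_two_two_le (n m : ℕ) :
    n ^ 2 * (sharingSet n m 2 2).card ≤ (2 * m) ^ 4 * n ^ (2 * m) := by
  refine sq_mul_card_le_of_coincidence _ fun t ht => ?_
  simp only [sharingSet, Finset.mem_filter, Finset.mem_univ, true_and] at ht
  obtain ⟨x, hx, y, hy, hxy⟩ := Finset.one_lt_card.mp (by omega : 1 < (commonIndices t).card)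
  simp only [commonIndices, Finset.mem_filter, Finset.mem_univ, true_and] at hx hy
  obtain ⟨x0, hx0⟩ := hx 0
  obtain ⟨x1, hx1⟩ := hx 1
  obtain ⟨y0, hy0⟩ := hy 0
  obtain ⟨y1, hy1⟩ := hy 1
  refine ⟨(1, x1), (1, y1), (0, x0), (0, y0), ?_, by simp, by simp, by simp, by simp,
    by simp [hx0, hx1], by simp [hy0, hy1]⟩
  rintro h
  simp only [Prod.mk.injEq, true_and] at h
  exact hxy (by rw [← hx1, ← hy1, h])

/-- One index common to three tuples already gives two constraints: the second and the third tuple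
each repeat the same entry of the first. -/
theorem sq_mul_card_sharingSet_three_one_le (n m : ℕ) :
    n ^ 2 * (sharingSet n m 3 1).card ≤ (3 * m) ^ 4 * n ^ (3 * m) := by
  refine sq_mul_card_le_of_coincidence _ fun t ht => ?_
  simp only [sharingSet, Finset.mem_filter, Finset.mem_univ, true_and] at ht
  obtain ⟨x, hx⟩ := Finset.card_pos.mp (by omega : 0 < (commonIndices t).card)
  simp only [commonIndices, Finset.mem_filter, Finset.mem_univ, true_and] at hx
  obtain ⟨x0, hx0⟩ := hx 0
  obtain ⟨x1, hx1⟩ := hx 1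
  obtain ⟨x2, hx2⟩ := hx 2
  exact ⟨(1, x1), (2, x2), (0, x0), (0, x0), by simp, by simp, by simp, by simp, by simp,
    by simp [hx0, hx1], by simp [hx0, hx2]⟩

theorem sum_sharingSet_eq {n m : ℕ} (a : (Fin m → Fin n) → ℝ) (K q : ℕ) :
    ∑ t ∈ sharingSet n m K q, |∏ k, a (t k)| = (sharingSet n m K q).card * avgWeight a K q := by
  unfold avgWeight
  -- If the set is empty the inverse is `0⁻¹ = 0`, and both sides vanish.
  rcases Nat.eq_zero_or_pos (sharingSet n m K q).card with h | h
  · rw [Finset.card_eq_zero.mp h]; simp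
  · rw [mul_inv_cancel_left₀]
    positivity

theorem avgWeight_nonneg {n m : ℕ} (a : (Fin m → Fin n) → ℝ) (K q : ℕ) : 0 ≤ avgWeight a K q :=
  mul_nonneg (by positivity) (Finset.sum_nonneg fun _ _ => abs_nonneg _)

/-- The normalising factor `(n - m)! / n!` of a U-statistic. -/
noncomputable def normalizer (n m : ℕ) : ℝ := ((n - m).factorial : ℝ) / (n.factorial : ℝ)

theorem normalizer_nonneg (n m : ℕ) : 0 ≤ normalizer n m := by
  unfold normalizer; positivity

/-- For `n ≥ 2 m` every factor of the falling factorial is at least `n / 2`. -/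
theorem normalizer_mul_pow_le {n m : ℕ} (hn : 2 * m ≤ n) : normalizer n m * (n : ℝ) ^ m ≤ 2 ^ m := by
  have hd := Nat.factorial_mul_descFactorial (by omega : m ≤ n)
  have hp := Nat.pow_sub_le_descFactorial n m
  have h1 : n ^ m ≤ 2 ^ m * n.descFactorial m := by
    calc n ^ m ≤ (2 * (n + 1 - m)) ^ m := Nat.pow_le_pow_left (by omega) _
      _ = 2 ^ m * (n + 1 - m) ^ m := mul_pow _ _ _
      _ ≤ _ := Nat.mul_le_mul_left _ hp
  unfold normalizer
  rw [div_mul_eq_mul_div, div_le_iff₀ (by positivity), ← hd]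
  have h2 : (n - m).factorial * n ^ m ≤ 2 ^ m * ((n - m).factorial * n.descFactorial m) := by
    calc _ ≤ (n - m).factorial * (2 ^ m * n.descFactorial m) := Nat.mul_le_mul_left _ h1
      _ = _ := by ring
  exact_mod_cast h2

theorem normalizer_pow_mul_card_le {n m K q C : ℕ} (hn : 2 * m ≤ n) (hn0 : 0 < n)
    (hC : n ^ 2 * (sharingSet n m K q).card ≤ C * n ^ (K * m)) :
    normalizer n m ^ K * (sharingSet n m K q).card ≤ 2 ^ (K * m) * C * (n : ℝ) ^ (-2 : ℝ) := by
  have hn' : (0 : ℝ) < n := by exact_mod_cast hn0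
  have h2 : (n : ℝ) ^ (-2 : ℝ) = ((n : ℝ) ^ 2)⁻¹ := by
    rw [Real.rpow_neg hn'.le]; norm_num
  rw [h2, ← div_eq_mul_inv, le_div_iff₀ (by positivity)]
  have hC' : (n : ℝ) ^ 2 * (sharingSet n m K q).card ≤ C * (n : ℝ) ^ (K * m) := by exact_mod_cast hC
  have h0 := normalizer_nonneg n m
  calc normalizer n m ^ K * (sharingSet n m K q).card * (n : ℝ) ^ 2
      = normalizer n m ^ K * ((n : ℝ) ^ 2 * (sharingSet n m K q).card) := by ring
    _ ≤ normalizer n m ^ K * (C * (n : ℝ) ^ (K * m)) := by gcongr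
    _ = C * (normalizer n m * (n : ℝ) ^ m) ^ K := by rw [mul_pow, ← pow_mul, mul_comm K m]; ring
    _ ≤ C * (2 ^ m) ^ K := by
        have := normalizer_mul_pow_le hn
        have h3 : 0 ≤ normalizer n m * (n : ℝ) ^ m := by positivity
        gcongr
    _ = _ := by rw [← pow_mul, mul_comm m K]; ring

theorem mem_indexSet {n m : ℕ} {t : Fin m → Fin n} :
    t ∈ indexSet n m ↔ Function.Injective t := by simp [indexSet]

/-! ### The Hoeffding decomposition to first order, as an algebraic identity. -/

section Projection

variable {𝓧 : Type*} [MeasurableSpace 𝓧]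

/-- The centred first-order projection of `h` onto its `l`-th argument, for the index tuple `t`. -/
noncomputable def centeredProj {n k : ℕ} (h : (Fin (k + 1) → 𝓧) → ℝ) (P : Fin n → Measure 𝓧)
    (t : Fin (k + 1) → Fin n) (l : Fin (k + 1)) (x : 𝓧) : ℝ :=
  proj h P l (fun j => t (l.succAbove j)) x - theta h P t

/-- What remains of `h` after removing its mean and its first-order projections. -/
noncomputable def residual {n k : ℕ} (h : (Fin (k + 1) → 𝓧) → ℝ) (P : Fin n → Measure 𝓧)
    (t : Fin (k + 1) → Fin n) (y : Fin (k + 1) → 𝓧) : ℝ :=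
  h y - theta h P t - ∑ l, centeredProj h P t l (y l)

/-- The total first-order contribution of the index `i` to the tuple `t`. -/
noncomputable def projAt {n k : ℕ} (h : (Fin (k + 1) → 𝓧) → ℝ) (P : Fin n → Measure 𝓧)
    (i : Fin n) (t : Fin (k + 1) → Fin n) (x : 𝓧) : ℝ :=
  ∑ l, if t l = i then centeredProj h P t l x else 0

/-- Inserting `i` at position `l` and deleting position `l` are mutually inverse. This moves the
first-order terms onto the index set over which the U-statistic is summed. -/
theorem sum_indexSetExcept_insertNth {n k : ℕ} (i : Fin n) (l : Fin (k + 1))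
    (F : (Fin (k + 1) → Fin n) → ℝ) :
    ∑ t ∈ indexSetExcept n k i, F (l.insertNth i t)
      = ∑ t ∈ indexSet n (k + 1), if t l = i then F t else 0 := by
  rw [← Finset.sum_filter]
  refine Finset.sum_nbij' (fun t => (l.insertNth i t : Fin (k + 1) → Fin n))
    (fun t j => t (l.succAbove j)) ?_ ?_ ?_ ?_ ?_
  · intro t ht
    simp only [indexSetExcept, Finset.mem_filter, Finset.mem_univ, true_and] at ht
    simp only [indexSet, Finset.mem_filter, Finset.mem_univ, true_and,
      Fin.insertNth_apply_same, and_true]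
    intro x y hxy
    induction x using l.succAboveCases with
    | x =>
      induction y using l.succAboveCases with
      | x => rfl
      | p j => simp only [Fin.insertNth_apply_same, Fin.insertNth_apply_succAbove] at hxy
               exact absurd hxy.symm (ht.2 j)
    | p j =>
      induction y using l.succAboveCases with
      | x => simp only [Fin.insertNth_apply_same, Fin.insertNth_apply_succAbove] at hxy
             exact absurd hxy (ht.2 j)
      | p j' => simp only [Fin.insertNth_apply_succAbove] at hxy
                rw [ht.1 hxy]
  · intro t ht
    simp only [indexSet, Finset.mem_filter, Finset.mem_univ, true_and] at ht
    simp only [indexSetExcept, Finset.mem_filter, Finset.mem_univ, true_and]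
    refine ⟨ht.1.comp Fin.succAbove_right_injective, fun j hj => ?_⟩
    exact Fin.succAbove_ne l j (ht.1 (hj.trans ht.2.symm))
  · intro t _
    funext j
    simp
  · intro t ht
    simp only [Finset.mem_filter] at ht
    rw [← ht.2]
    exact Fin.insertNth_self_removeNth l t
  · intro t _
    rfl

theorem inv_mul_firstOrder {n k : ℕ} (a : (Fin (k + 1) → Fin n) → ℝ)
    (h : (Fin (k + 1) → 𝓧) → ℝ) (P : Fin n → Measure 𝓧) (i : Fin n) (x : 𝓧) :
    (n : ℝ)⁻¹ * firstOrder a h P i x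
      = normalizer n (k + 1) * ∑ t ∈ indexSet n (k + 1), a t * projAt h P i t x := by
  have hn : 0 < n := i.pos
  -- The factor `n⁻¹` completes `(n - 1)!` to `n!`, so the projection has the same normalizer as the
  -- U-statistic.
  have hc : (n : ℝ)⁻¹ * (((n - (k + 1)).factorial : ℝ) / ((n - 1).factorial : ℝ))
      = normalizer n (k + 1) := by
    unfold normalizer
    rw [← Nat.mul_factorial_pred hn.ne']
    push_cast
    field_simp
  unfold firstOrder firstOrderAt
  rw [← mul_assoc, hc, Finset.sum_comm]
  congr 1
  have : ∀ l : Fin (k + 1), ∑ t ∈ indexSetExcept n k i,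
      a (l.insertNth i t) * (proj h P l t x - theta h P (l.insertNth i t))
      = ∑ t ∈ indexSet n (k + 1), if t l = i then a t * centeredProj h P t l x else 0 := by
    intro l
    rw [← sum_indexSetExcept_insertNth]
    refine Finset.sum_congr rfl fun t _ => ?_
    simp [centeredProj]
  rw [Finset.sum_congr rfl fun l _ => this l, Finset.sum_comm]
  refine Finset.sum_congr rfl fun t _ => ?_
  unfold projAt
  rw [Finset.mul_sum]
  refine Finset.sum_congr rfl fun l _ => ?_
  rw [mul_ite, mul_zero]

theorem sum_projAt {n k : ℕ} (h : (Fin (k + 1) → 𝓧) → ℝ) (P : Fin n → Measure 𝓧)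
    (t : Fin (k + 1) → Fin n) (x : Fin n → 𝓧) :
    ∑ i, projAt h P i t (x i) = ∑ l, centeredProj h P t l (x (t l)) := by
  unfold projAt
  rw [Finset.sum_comm]
  simp

theorem projAt_apply {n k : ℕ} (h : (Fin (k + 1) → 𝓧) → ℝ) (P : Fin n → Measure 𝓧)
    {t : Fin (k + 1) → Fin n} (ht : Function.Injective t) (l : Fin (k + 1)) (x : 𝓧) :
    projAt h P (t l) t x = centeredProj h P t l x := by
  simp [projAt, ht.eq_iff]

theorem projAt_of_notMem {n k : ℕ} (h : (Fin (k + 1) → 𝓧) → ℝ) (P : Fin n → Measure 𝓧)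
    {i : Fin n} {t : Fin (k + 1) → Fin n} (hi : ∀ l, t l ≠ i) (x : 𝓧) :
    projAt h P i t x = 0 := by
  simp [projAt, hi]

/-- The kernel is split tuple by tuple, and the projections are then regrouped by index instead of
by position. Neither independence nor integrability enters. -/
theorem uStat_eq {n k : ℕ} (a : (Fin (k + 1) → Fin n) → ℝ) (h : (Fin (k + 1) → 𝓧) → ℝ)
    (P : Fin n → Measure 𝓧) (x : Fin n → 𝓧) :
    uStat a h x = normalizer n (k + 1) * ∑ t ∈ indexSet n (k + 1), a t * theta h P t
      + ∑ i, (n : ℝ)⁻¹ * firstOrder a h P i (x i)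
      + normalizer n (k + 1) * ∑ t ∈ indexSet n (k + 1),
          a t * residual h P t (fun j => x (t j)) := by
  simp_rw [inv_mul_firstOrder]
  rw [← Finset.mul_sum, Finset.sum_comm, ← mul_add, ← mul_add, ← Finset.sum_add_distrib,
    ← Finset.sum_add_distrib]
  unfold uStat normalizer
  congr 1
  refine Finset.sum_congr rfl fun t _ => ?_
  rw [← Finset.mul_sum, sum_projAt]
  unfold residual
  ring

end Projection

end WeightedU

/-! ### Second and third moments controlled by the fourth. -/

section FourthMoment

variable {Ω : Type*} [MeasurableSpace Ω] {μ : Measure Ω}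

theorem memLp_four_of_integrable_pow {f : Ω → ℝ} (hfm : Measurable f)
    (hf : Integrable (fun ω => f ω ^ 4) μ) : MemLp f 4 μ := by
  rw [← integrable_norm_rpow_iff hfm.aestronglyMeasurable (by norm_num) (by norm_num)]
  refine hf.congr (Eventually.of_forall fun ω => ?_)
  have : (4 : ENNReal).toReal = ((4 : ℕ) : ℝ) := by norm_num
  simp only [this, Real.rpow_natCast, Real.norm_eq_abs]
  rw [Even.pow_abs (by decide)]

/-- Arithmetic-geometric mean inequality for `√M` and `x⁴ / √M`. Being affine in `x⁴`, the bound can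
be integrated directly. -/
theorem sq_le_of_pos {M : ℝ} (hM : 0 < M) (x : ℝ) :
    x ^ 2 ≤ (M ^ (1 / 2 : ℝ) + x ^ 4 * (M ^ (1 / 2 : ℝ))⁻¹) / 2 := by
  have hr : 0 < M ^ (1 / 2 : ℝ) := Real.rpow_pos_of_pos hM _
  set r := M ^ (1 / 2 : ℝ)
  rw [← div_eq_mul_inv, le_div_iff₀ (by norm_num), ← sub_nonneg]
  have : r + x ^ 4 / r - x ^ 2 * 2 = (r - x ^ 2) ^ 2 / r := by field_simp; ring
  rw [this]
  positivity

/-- With `r = M^(1/4)`, the first summand suffices when `|x| ≤ r` and the second when `|x| ≥ r`. -/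
theorem abs_cube_le_of_pos {M : ℝ} (hM : 0 < M) (x : ℝ) :
    |x| ^ 3 ≤ M ^ (3 / 4 : ℝ) + x ^ 4 * (M ^ (1 / 4 : ℝ))⁻¹ := by
  have hr : 0 < M ^ (1 / 4 : ℝ) := Real.rpow_pos_of_pos hM _
  have h3 : M ^ (3 / 4 : ℝ) = (M ^ (1 / 4 : ℝ)) ^ 3 := by
    rw [← Real.rpow_natCast, ← Real.rpow_mul hM.le]; norm_num
  rw [h3]
  set r := M ^ (1 / 4 : ℝ)
  have h4 : x ^ 4 = |x| ^ 4 := (Even.pow_abs (by decide) x).symm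
  have hx := abs_nonneg x
  rw [h4]
  rcases le_total |x| r with h | h
  · have : |x| ^ 3 ≤ r ^ 3 := pow_le_pow_left₀ hx h 3
    have : 0 ≤ |x| ^ 4 * r⁻¹ := by positivity
    linarith
  · have : |x| ^ 3 ≤ |x| ^ 4 * r⁻¹ := by
      rw [← div_eq_mul_inv, le_div_iff₀ hr, pow_succ |x| 3]
      exact mul_le_mul_of_nonneg_left h (by positivity)
    have : 0 ≤ r ^ 3 := by positivity
    linarith

theorem rpow_half_mul_inv {M : ℝ} (hM : 0 < M) :
    M * (M ^ (1 / 2 : ℝ))⁻¹ = M ^ (1 / 2 : ℝ) := by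
  rw [← Real.rpow_neg hM.le]
  nth_rewrite 1 [← Real.rpow_one M]
  rw [← Real.rpow_add hM]; norm_num

theorem rpow_quarter_mul_inv {M : ℝ} (hM : 0 < M) :
    M * (M ^ (1 / 4 : ℝ))⁻¹ = M ^ (3 / 4 : ℝ) := by
  rw [← Real.rpow_neg hM.le]
  nth_rewrite 1 [← Real.rpow_one M]
  rw [← Real.rpow_add hM]; norm_num

theorem sq_le_of_pow_four_le {M x : ℝ} (hM : 0 < M) (hx : x ^ 4 ≤ M) :
    x ^ 2 ≤ M ^ (1 / 2 : ℝ) := by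
  have h := sq_le_of_pos hM x
  have hr : 0 < M ^ (1 / 2 : ℝ) := Real.rpow_pos_of_pos hM _
  have := mul_le_mul_of_nonneg_right hx (inv_nonneg.mpr hr.le)
  rw [rpow_half_mul_inv hM] at this
  linarith

theorem abs_cube_le_of_pow_four_le {M x : ℝ} (hM : 0 < M) (hx : x ^ 4 ≤ M) :
    |x| ^ 3 ≤ 2 * M ^ (3 / 4 : ℝ) := by
  have h := abs_cube_le_of_pos hM x
  have hr : 0 < M ^ (1 / 4 : ℝ) := Real.rpow_pos_of_pos hM _
  have := mul_le_mul_of_nonneg_right hx (inv_nonneg.mpr hr.le)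
  rw [rpow_quarter_mul_inv hM] at this
  linarith

theorem pow_four_integral_le [IsProbabilityMeasure μ] {f : Ω → ℝ} (hf : Integrable f μ)
    (hf4 : Integrable (fun ω => f ω ^ 4) μ) : (∫ ω, f ω ∂μ) ^ 4 ≤ ∫ ω, f ω ^ 4 ∂μ :=
  ConvexOn.map_integral_le (g := fun x : ℝ => x ^ 4) (Even.convexOn_pow (by decide))
    (by fun_prop) isClosed_univ (by simp) hf hf4

variable [IsProbabilityMeasure μ]

theorem integral_sq_le_of_integral_pow_four_le {f : Ω → ℝ} (hfm : Measurable f)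
    (hf : Integrable (fun ω => f ω ^ 4) μ) {M : ℝ} (hM : 0 < M)
    (h : ∫ ω, f ω ^ 4 ∂μ ≤ M) : ∫ ω, f ω ^ 2 ∂μ ≤ M ^ (1 / 2 : ℝ) := by
  have h2 : Integrable (fun ω => f ω ^ 2) μ :=
    ((memLp_four_of_integrable_pow hfm hf).mono_exponent
      (by norm_num : (2 : ENNReal) ≤ 4)).integrable_sq
  have hr : 0 < M ^ (1 / 2 : ℝ) := Real.rpow_pos_of_pos hM _
  have hi := hf.mul_const (M ^ (1 / 2 : ℝ))⁻¹
  have hc : Integrable (fun _ : Ω => M ^ (1 / 2 : ℝ)) μ := integrable_const _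
  calc ∫ ω, f ω ^ 2 ∂μ
      ≤ ∫ ω, (M ^ (1 / 2 : ℝ) + f ω ^ 4 * (M ^ (1 / 2 : ℝ))⁻¹) / 2 ∂μ :=
        integral_mono h2 ((hc.add hi).div_const 2) fun ω => sq_le_of_pos hM (f ω)
    _ = (M ^ (1 / 2 : ℝ) + (∫ ω, f ω ^ 4 ∂μ) * (M ^ (1 / 2 : ℝ))⁻¹) / 2 := by
        rw [integral_div, integral_add hc hi, integral_mul_const]; simp
    _ ≤ (M ^ (1 / 2 : ℝ) + M * (M ^ (1 / 2 : ℝ))⁻¹) / 2 := by gcongr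
    _ = _ := by rw [rpow_half_mul_inv hM]; ring

theorem integral_abs_cube_le_of_integral_pow_four_le {f : Ω → ℝ} (hfm : Measurable f)
    (hf : Integrable (fun ω => f ω ^ 4) μ) {M : ℝ} (hM : 0 < M)
    (h : ∫ ω, f ω ^ 4 ∂μ ≤ M) : ∫ ω, |f ω| ^ 3 ∂μ ≤ 2 * M ^ (3 / 4 : ℝ) := by
  have h3 : Integrable (fun ω => |f ω| ^ 3) μ :=
    integrable_abs_pow_of_memLp (p := 3) (by norm_num)
      ((memLp_four_of_integrable_pow hfm hf).mono_exponent (by norm_num))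
  have hr : 0 < M ^ (1 / 4 : ℝ) := Real.rpow_pos_of_pos hM _
  have hi := hf.mul_const (M ^ (1 / 4 : ℝ))⁻¹
  have hc : Integrable (fun _ : Ω => M ^ (3 / 4 : ℝ)) μ := integrable_const _
  calc ∫ ω, |f ω| ^ 3 ∂μ
      ≤ ∫ ω, (M ^ (3 / 4 : ℝ) + f ω ^ 4 * (M ^ (1 / 4 : ℝ))⁻¹) ∂μ :=
        integral_mono h3 (hc.add hi) fun ω => abs_cube_le_of_pos hM (f ω)
    _ = (M ^ (3 / 4 : ℝ) + (∫ ω, f ω ^ 4 ∂μ) * (M ^ (1 / 4 : ℝ))⁻¹) := by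
        rw [integral_add hc hi, integral_mul_const]; simp
    _ ≤ (M ^ (3 / 4 : ℝ) + M * (M ^ (1 / 4 : ℝ))⁻¹) := by gcongr
    _ = _ := by rw [rpow_quarter_mul_inv hM]; ring

end FourthMoment

/-! ### Integrating out an independent variable. -/

section Fubini

variable {Ω 𝓦 𝓨 : Type*} [MeasurableSpace Ω] [MeasurableSpace 𝓦] [MeasurableSpace 𝓨]
  {μ : Measure Ω} [IsProbabilityMeasure μ] {W : Ω → 𝓦} {Y : Ω → 𝓨}

theorem IndepFun.integrable_map_prod (hW : Measurable W) (hY : Measurable Y)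
    (hWY : IndepFun W Y μ) {Φ : 𝓦 × 𝓨 → ℝ} (hΦ : Measurable Φ)
    (hi : Integrable (fun ω => Φ (W ω, Y ω)) μ) :
    Integrable Φ ((μ.map W).prod (μ.map Y)) := by
  rw [← hWY.map_prod_eq_prod_map_map hW.aemeasurable hY.aemeasurable]
  exact (integrable_map_measure hΦ.aestronglyMeasurable (hW.prodMk hY).aemeasurable).mpr hi

theorem IndepFun.integral_eq_integral_integral (hW : Measurable W) (hY : Measurable Y)
    (hWY : IndepFun W Y μ) {Φ : 𝓦 × 𝓨 → ℝ} (hΦ : Measurable Φ)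
    (hi : Integrable (fun ω => Φ (W ω, Y ω)) μ) :
    ∫ ω, Φ (W ω, Y ω) ∂μ = ∫ ω, ∫ y, Φ (W ω, y) ∂(μ.map Y) ∂μ := by
  have := Measure.isProbabilityMeasure_map (μ := μ) hY.aemeasurable
  have := Measure.isProbabilityMeasure_map (μ := μ) hW.aemeasurable
  have hm : StronglyMeasurable fun w => ∫ y, Φ (w, y) ∂(μ.map Y) :=
    hΦ.stronglyMeasurable.integral_prod_right'
  rw [← integral_map (f := fun w => ∫ y, Φ (w, y) ∂(μ.map Y)) hW.aemeasurable
      hm.aestronglyMeasurable,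
    ← integral_prod _ (IndepFun.integrable_map_prod hW hY hWY hΦ hi),
    ← hWY.map_prod_eq_prod_map_map hW.aemeasurable hY.aemeasurable,
    integral_map (hW.prodMk hY).aemeasurable hΦ.aestronglyMeasurable]

theorem IndepFun.integrable_integral (hW : Measurable W) (hY : Measurable Y)
    (hWY : IndepFun W Y μ) {Φ : 𝓦 × 𝓨 → ℝ} (hΦ : Measurable Φ)
    (hi : Integrable (fun ω => Φ (W ω, Y ω)) μ) :
    Integrable (fun ω => ∫ y, Φ (W ω, y) ∂(μ.map Y)) μ := by
  have := Measure.isProbabilityMeasure_map (μ := μ) hY.aemeasurable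
  have := Measure.isProbabilityMeasure_map (μ := μ) hW.aemeasurable
  exact (IndepFun.integrable_map_prod hW hY hWY hΦ hi).integral_prod_left.comp_measurable hW

theorem IndepFun.ae_integrable (hW : Measurable W) (hY : Measurable Y)
    (hWY : IndepFun W Y μ) {Φ : 𝓦 × 𝓨 → ℝ} (hΦ : Measurable Φ)
    (hi : Integrable (fun ω => Φ (W ω, Y ω)) μ) :
    ∀ᵐ ω ∂μ, Integrable (fun y => Φ (W ω, y)) (μ.map Y) := by
  have := Measure.isProbabilityMeasure_map (μ := μ) hY.aemeasurable
  have := Measure.isProbabilityMeasure_map (μ := μ) hW.aemeasurable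
  exact ae_of_ae_map hW.aemeasurable (IndepFun.integrable_map_prod hW hY hWY hΦ hi).prod_right_ae

end Fubini

/-! ### Moments of the projections and orthogonality of the residual. -/

namespace WeightedU

section Residual

theorem insertNth_tuple {𝓧 : Type*} {n k : ℕ} {t : Fin (k + 1) → Fin n}
    (l : Fin (k + 1)) (x : Fin n → 𝓧) :
    (l.insertNth (x (t l)) (fun j => x (t (l.succAbove j))) : Fin (k + 1) → 𝓧)
      = fun j => x (t j) := 
  Fin.insertNth_self_removeNth l (fun j => x (t j))

variable {𝓧 : Type*} [MeasurableSpace 𝓧] {Ω : Type*} [MeasurableSpace Ω] {μ : Measure Ω}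
  {n k : ℕ} {h : (Fin (k + 1) → 𝓧) → ℝ} {X : Fin n → Ω → 𝓧} {t : Fin (k + 1) → Fin n}

theorem map_tuple_eq_pi {m : ℕ} (hX : ∀ i, Measurable (X i)) (hind : iIndepFun X μ)
    {s : Fin m → Fin n} (hs : Function.Injective s) :
    μ.map (fun ω j => X (s j) ω) = Measure.pi fun j => μ.map (X (s j)) :=
  (hind.precomp hs).map_fun_eq_pi_map fun j => (hX (s j)).aemeasurable

theorem memLp_kernel (hh : Measurable h) (hX : ∀ i, Measurable (X i))
    (h4 : Integrable (fun ω => h (fun j => X (t j) ω) ^ 4) μ) :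
    MemLp (fun ω => h (fun j => X (t j) ω)) 4 μ :=
  memLp_four_of_integrable_pow (by fun_prop) h4

theorem measurable_insertNth (l : Fin (k + 1)) :
    Measurable fun p : 𝓧 × (Fin k → 𝓧) => (l.insertNth p.1 p.2 : Fin (k + 1) → 𝓧) :=
  (MeasurableEquiv.piFinSuccAbove (fun _ => 𝓧) l).symm.measurable

theorem measurable_proj (hh : Measurable h) (P : Fin n → Measure 𝓧)
    [∀ i, IsProbabilityMeasure (P i)] (l : Fin (k + 1)) (s : Fin k → Fin n) :
    Measurable (proj h P l s) :=
  ((hh.comp (measurable_insertNth l)).stronglyMeasurable.integral_prod_right'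
    (ν := Measure.pi fun j => P (s j))).measurable

theorem measurable_centeredProj (hh : Measurable h) (P : Fin n → Measure 𝓧)
    [∀ i, IsProbabilityMeasure (P i)] (t : Fin (k + 1) → Fin n) (l : Fin (k + 1)) :
    Measurable (centeredProj h P t l) :=
  (measurable_proj hh P l _).sub_const _

theorem measurable_residual (hh : Measurable h) (P : Fin n → Measure 𝓧)
    [∀ i, IsProbabilityMeasure (P i)] (t : Fin (k + 1) → Fin n) :
    Measurable (residual h P t) := by
  unfold residual
  have := measurable_centeredProj hh P t
  fun_prop

theorem indepFun_restrict_tuple {m : ℕ} (hX : ∀ i, Measurable (X i)) (hind : iIndepFun X μ)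
    (S : Finset (Fin n)) (s : Fin m → Fin n) (hs : ∀ j, s j ∉ S) :
    IndepFun (fun ω (i : S) => X i ω) (fun ω j => X (s j) ω) μ := by
  classical
  have hd : Disjoint S (Finset.univ.image s) := by
    rw [Finset.disjoint_right]
    intro i hi
    obtain ⟨j, -, rfl⟩ := Finset.mem_image.mp hi
    exact hs j
  have hI := hind.indepFun_finset S (Finset.univ.image s) hd hX
  have hψ : Measurable fun (y : ↥(Finset.univ.image s) → 𝓧) j =>
      y ⟨s j, Finset.mem_image_of_mem s (Finset.mem_univ j)⟩ := by fun_prop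
  exact hI.comp measurable_id hψ

theorem indepFun_coordinate_tuple (hX : ∀ i, Measurable (X i)) (hind : iIndepFun X μ)
    (ht : Function.Injective t) (l : Fin (k + 1)) :
    IndepFun (X (t l)) (fun ω j => X (t (l.succAbove j)) ω) μ := by
  have hI := indepFun_restrict_tuple hX hind {t l} (fun j => t (l.succAbove j)) (fun j => by
    rw [Finset.mem_singleton]
    exact fun e => Fin.succAbove_ne l j (ht e))
  exact hI.comp (φ := fun y : ({t l} : Finset (Fin n)) → 𝓧 => y ⟨t l, Finset.mem_singleton_self _⟩)
    (ψ := id) (by fun_prop) measurable_id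

theorem theta_eq_integral (hh : Measurable h) (hX : ∀ i, Measurable (X i))
    (hind : iIndepFun X μ) (ht : Function.Injective t) :
    theta h (fun j => μ.map (X j)) t = ∫ ω, h (fun j => X (t j) ω) ∂μ := by
  unfold theta
  rw [← map_tuple_eq_pi hX hind ht,
    integral_map (by fun_prop) hh.aestronglyMeasurable]

theorem proj_eq_integral_map (hX : ∀ i, Measurable (X i)) (hind : iIndepFun X μ)
    (ht : Function.Injective t) (l : Fin (k + 1)) (x : 𝓧) :
    proj h (fun j => μ.map (X j)) l (fun j => t (l.succAbove j)) x
      = ∫ y, h (l.insertNth x y) ∂(μ.map fun ω j => X (t (l.succAbove j)) ω) := by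
  unfold proj
  rw [map_tuple_eq_pi hX hind (s := fun j => t (l.succAbove j))
    (ht.comp Fin.succAbove_right_injective)]

variable [IsProbabilityMeasure μ]

theorem integrable_kernel (hh : Measurable h) (hX : ∀ i, Measurable (X i))
    (h4 : Integrable (fun ω => h (fun j => X (t j) ω) ^ 4) μ) :
    Integrable (fun ω => h (fun j => X (t j) ω)) μ :=
  (memLp_kernel hh hX h4).integrable (by norm_num)

section

theorem integral_proj
    (hh : Measurable h) (hX : ∀ i, Measurable (X i)) (hind : iIndepFun X μ)
    (ht : Function.Injective t) (h4 : Integrable (fun ω => h (fun j => X (t j) ω) ^ 4) μ)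
    (l : Fin (k + 1)) :
    Integrable (fun ω => proj h (fun j => μ.map (X j)) l (fun j => t (l.succAbove j))
      (X (t l) ω)) μ ∧
    ∫ ω, proj h (fun j => μ.map (X j)) l (fun j => t (l.succAbove j)) (X (t l) ω) ∂μ
      = theta h (fun j => μ.map (X j)) t := by
  have hI := indepFun_coordinate_tuple hX hind ht l
  have hY : Measurable fun ω j => X (t (Fin.succAbove l j)) ω := by fun_prop
  have hΦ := hh.comp (measurable_insertNth l)
  have hi : Integrable (fun ω => (h ∘ fun p : 𝓧 × (Fin k → 𝓧) =>
      (l.insertNth p.1 p.2 : Fin (k + 1) → 𝓧)) (X (t l) ω, fun j => X (t (l.succAbove j)) ω)) μ := by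
    refine (integrable_kernel hh hX h4).congr (Eventually.of_forall fun ω => ?_)
    exact congrArg h (insertNth_tuple l fun i => X i ω).symm
  simp_rw [proj_eq_integral_map hX hind ht l]
  refine ⟨IndepFun.integrable_integral (hX _) hY hI hΦ hi, ?_⟩
  rw [theta_eq_integral hh hX hind ht]
  refine (IndepFun.integral_eq_integral_integral (hX _) hY hI hΦ hi).symm.trans ?_
  refine integral_congr_ae (Eventually.of_forall fun ω => ?_)
  exact congrArg h (insertNth_tuple l fun i => X i ω)

/-- The projection is the conditional mean of the kernel given one argument. Jensen's inequality for
the inner integral, valid for almost every value of that argument, followed by Fubini shows that the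
fourth moment does not increase. -/
theorem integral_proj_pow_four
    (hh : Measurable h) (hX : ∀ i, Measurable (X i)) (hind : iIndepFun X μ)
    (ht : Function.Injective t) (h4 : Integrable (fun ω => h (fun j => X (t j) ω) ^ 4) μ)
    (l : Fin (k + 1)) :
    Integrable (fun ω => proj h (fun j => μ.map (X j)) l (fun j => t (l.succAbove j))
      (X (t l) ω) ^ 4) μ ∧
    ∫ ω, proj h (fun j => μ.map (X j)) l (fun j => t (l.succAbove j)) (X (t l) ω) ^ 4 ∂μ
      ≤ ∫ ω, h (fun j => X (t j) ω) ^ 4 ∂μ := by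
  have hI := indepFun_coordinate_tuple hX hind ht l
  have hY : Measurable fun ω j => X (t (Fin.succAbove l j)) ω := by fun_prop
  have := Measure.isProbabilityMeasure_map (μ := μ) hY.aemeasurable
  have := fun i => Measure.isProbabilityMeasure_map (μ := μ) (hX i).aemeasurable
  have hΦ := hh.comp (measurable_insertNth l)
  have hi : Integrable (fun ω => (h ∘ fun p : 𝓧 × (Fin k → 𝓧) =>
      (l.insertNth p.1 p.2 : Fin (k + 1) → 𝓧)) (X (t l) ω, fun j => X (t (l.succAbove j)) ω)) μ := by
    refine (integrable_kernel hh hX h4).congr (Eventually.of_forall fun ω => ?_)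
    exact congrArg h (insertNth_tuple l fun i => X i ω).symm
  have hi4 : Integrable (fun ω => (fun q => (h ∘ fun p : 𝓧 × (Fin k → 𝓧) =>
      (l.insertNth p.1 p.2 : Fin (k + 1) → 𝓧)) q ^ 4)
      (X (t l) ω, fun j => X (t (l.succAbove j)) ω)) μ := by
    refine h4.congr (Eventually.of_forall fun ω => ?_)
    exact congrArg (fun y => h y ^ 4) (insertNth_tuple l fun i => X i ω).symm
  have hb := IndepFun.integrable_integral (hX _) hY hI (hΦ.pow_const 4) hi4
  have hle : ∀ᵐ ω ∂μ,
      proj h (fun j => μ.map (X j)) l (fun j => t (l.succAbove j)) (X (t l) ω) ^ 4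
        ≤ ∫ y, h (l.insertNth (X (t l) ω) y) ^ 4
          ∂(μ.map fun ω j => X (t (l.succAbove j)) ω) := by
    filter_upwards [IndepFun.ae_integrable (hX _) hY hI hΦ hi,
      IndepFun.ae_integrable (hX _) hY hI (hΦ.pow_const 4) hi4] with ω h1 h2
    rw [proj_eq_integral_map hX hind ht l]
    exact pow_four_integral_le h1 h2
  have hint : Integrable (fun ω => proj h (fun j => μ.map (X j)) l
      (fun j => t (l.succAbove j)) (X (t l) ω) ^ 4) μ := by
    refine hb.mono' ?_ ?_
    · exact (((measurable_proj hh _ l _).comp (hX _)).pow_const 4).aestronglyMeasurable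
    · filter_upwards [hle] with ω hω
      rw [Real.norm_of_nonneg (by positivity)]
      exact hω
  refine ⟨hint, (integral_mono_ae hint hb hle).trans (le_of_eq ?_)⟩
  refine (IndepFun.integral_eq_integral_integral (hX _) hY hI (hΦ.pow_const 4) hi4).symm.trans ?_
  refine integral_congr_ae (Eventually.of_forall fun ω => ?_)
  exact congrArg (fun y => h y ^ 4) (insertNth_tuple l fun i => X i ω)

theorem memLp_centeredProj
    (hh : Measurable h) (hX : ∀ i, Measurable (X i)) (hind : iIndepFun X μ)
    (ht : Function.Injective t) (h4 : Integrable (fun ω => h (fun j => X (t j) ω) ^ 4) μ)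
    (l : Fin (k + 1)) :
    MemLp (fun ω => centeredProj h (fun j => μ.map (X j)) t l (X (t l) ω)) 4 μ := by
  have := fun i => Measure.isProbabilityMeasure_map (μ := μ) (hX i).aemeasurable
  exact (memLp_four_of_integrable_pow ((measurable_proj hh _ l _).comp (hX _))
    (integral_proj_pow_four hh hX hind ht h4 l).1).sub (memLp_const _)

theorem integral_centeredProj
    (hh : Measurable h) (hX : ∀ i, Measurable (X i)) (hind : iIndepFun X μ)
    (ht : Function.Injective t) (h4 : Integrable (fun ω => h (fun j => X (t j) ω) ^ 4) μ)
    (l : Fin (k + 1)) :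
    ∫ ω, centeredProj h (fun j => μ.map (X j)) t l (X (t l) ω) ∂μ = 0 := by
  obtain ⟨h1, h2⟩ := integral_proj hh hX hind ht h4 l
  unfold centeredProj
  rw [integral_sub h1 (integrable_const _), h2]
  simp

theorem memLp_residual
    (hh : Measurable h) (hX : ∀ i, Measurable (X i)) (hind : iIndepFun X μ)
    (ht : Function.Injective t) (h4 : Integrable (fun ω => h (fun j => X (t j) ω) ^ 4) μ) :
    MemLp (fun ω => residual h (fun j => μ.map (X j)) t (fun j => X (t j) ω)) 4 μ := by
  unfold residual
  refine ((memLp_kernel hh hX h4).sub (memLp_const _)).sub ?_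
  exact memLp_finsetSum _ fun l _ => memLp_centeredProj hh hX hind ht h4 l

theorem pow_four_theta_le
    (hh : Measurable h) (hX : ∀ i, Measurable (X i)) (hind : iIndepFun X μ)
    (ht : Function.Injective t) (h4 : Integrable (fun ω => h (fun j => X (t j) ω) ^ 4) μ)
    {M : ℝ} (hM4 : ∫ ω, h (fun j => X (t j) ω) ^ 4 ∂μ ≤ M) :
    theta h (fun j => μ.map (X j)) t ^ 4 ≤ M := by
  rw [theta_eq_integral hh hX hind ht]
  exact (pow_four_integral_le (integrable_kernel hh hX h4) h4).trans hM4

theorem integral_abs_cube_centeredProj_le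
    (hh : Measurable h) (hX : ∀ i, Measurable (X i)) (hind : iIndepFun X μ)
    (ht : Function.Injective t) (h4 : Integrable (fun ω => h (fun j => X (t j) ω) ^ 4) μ)
    {M : ℝ} (hM : 0 < M)
    (hM4 : ∫ ω, h (fun j => X (t j) ω) ^ 4 ∂μ ≤ M) (l : Fin (k + 1)) :
    ∫ ω, |centeredProj h (fun j => μ.map (X j)) t l (X (t l) ω)| ^ 3 ∂μ
      ≤ 16 * M ^ (3 / 4 : ℝ) := by
  have := fun i => Measure.isProbabilityMeasure_map (μ := μ) (hX i).aemeasurable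
  obtain ⟨hp, hp4⟩ := integral_proj_pow_four hh hX hind ht h4 l
  have hm := (measurable_proj hh (fun j => μ.map (X j)) l fun j => t (l.succAbove j)).comp
    (hX (t l))
  have h3 := integral_abs_cube_le_of_integral_pow_four_le hm hp hM (hp4.trans hM4)
  have hθ := abs_cube_le_of_pow_four_le hM (pow_four_theta_le hh hX hind ht h4 hM4)
  have hi3 := integrable_abs_pow_of_memLp (p := 3) (by norm_num)
    ((memLp_four_of_integrable_pow hm hp).mono_exponent (by norm_num))
  have hc3 := integrable_abs_pow_of_memLp (p := 3) (by norm_num)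
    ((memLp_centeredProj hh hX hind ht h4 l).mono_exponent (by norm_num))
  set θ := theta h (fun j => μ.map (X j)) t
  have key := integral_mono (μ := μ) hc3 ((hi3.add (integrable_const (|θ| ^ 3))).const_mul 4)
    (fun ω => by
      simp only [Pi.add_apply, Function.comp_apply, centeredProj]
      set u := proj h (fun j => μ.map (X j)) l (fun j => t (l.succAbove j)) (X (t l) ω)
      change |u - θ| ^ 3 ≤ _
      have h1 : |u - θ| ≤ |u| + |θ| := abs_sub u θ
      have hu := abs_nonneg u
      have hv := abs_nonneg θ
      refine (pow_le_pow_left₀ (abs_nonneg _) h1 3).trans ?_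
      -- This is `(a + b)³ ≤ 4 (a³ + b³)`, the gap being `3 (a + b)(a - b)²`. As both cubes
      -- contribute at most `2 M^(3/4)`, the constant is `4 · (2 + 2) = 16`.
      nlinarith [mul_nonneg (add_nonneg hu hv) (sq_nonneg (|u| - |θ|))])
  refine key.trans ?_
  rw [integral_const_mul]
  simp only [Pi.add_apply]
  rw [integral_add hi3 (integrable_const _), integral_const]
  simp only [probReal_univ, one_smul]
  linarith

theorem integral_sq_residual_le
    (hh : Measurable h) (hX : ∀ i, Measurable (X i)) (hind : iIndepFun X μ)
    (ht : Function.Injective t) (h4 : Integrable (fun ω => h (fun j => X (t j) ω) ^ 4) μ)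
    {M : ℝ} (hM : 0 < M)
    (hM4 : ∫ ω, h (fun j => X (t j) ω) ^ 4 ∂μ ≤ M) :
    ∫ ω, residual h (fun j => μ.map (X j)) t (fun j => X (t j) ω) ^ 2 ∂μ
      ≤ (8 + 8 * (k + 1 : ℝ) ^ 2) * M ^ (1 / 2 : ℝ) := by
  have := fun i => Measure.isProbabilityMeasure_map (μ := μ) (hX i).aemeasurable
  have hθ := sq_le_of_pow_four_le hM (pow_four_theta_le hh hX hind ht h4 hM4)
  set θ := theta h (fun j => μ.map (X j)) t with hθdef
  -- Used for the kernel and for each projection, all of which have fourth moment at most `M`.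
  have hcent : ∀ u : Ω → ℝ, Measurable u → Integrable (fun ω => u ω ^ 4) μ →
      ∫ ω, u ω ^ 4 ∂μ ≤ M → Integrable (fun ω => (u ω - θ) ^ 2) μ ∧
      ∫ ω, (u ω - θ) ^ 2 ∂μ ≤ 4 * M ^ (1 / 2 : ℝ) := by
    intro u hu hu4 huM
    have hL := (memLp_four_of_integrable_pow hu hu4).mono_exponent
      (by norm_num : (2 : ENNReal) ≤ 4)
    have h1 : Integrable (fun ω => (u ω - θ) ^ 2) μ := (hL.sub (memLp_const θ)).integrable_sq
    have h2 := hL.integrable_sq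
    refine ⟨h1, ?_⟩
    calc ∫ ω, (u ω - θ) ^ 2 ∂μ ≤ ∫ ω, (2 * u ω ^ 2 + 2 * θ ^ 2) ∂μ :=
          integral_mono h1 ((h2.const_mul 2).add (integrable_const _)) fun ω => by
            change (u ω - θ) ^ 2 ≤ 2 * u ω ^ 2 + 2 * θ ^ 2
            nlinarith [sq_nonneg (u ω + θ)]
      _ = 2 * ∫ ω, u ω ^ 2 ∂μ + 2 * θ ^ 2 := by
          rw [integral_add (h2.const_mul 2) (integrable_const _), integral_const_mul]; simp
      _ ≤ _ := by
          have := integral_sq_le_of_integral_pow_four_le hu hu4 hM huM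
          linarith
  obtain ⟨ha, hb⟩ := hcent _ (by fun_prop) h4 hM4
  have hl : ∀ l, Integrable (fun ω =>
      centeredProj h (fun j => μ.map (X j)) t l (X (t l) ω) ^ 2) μ ∧
      ∫ ω, centeredProj h (fun j => μ.map (X j)) t l (X (t l) ω) ^ 2 ∂μ
        ≤ 4 * M ^ (1 / 2 : ℝ) := fun l => by
    obtain ⟨hp, hp4⟩ := integral_proj_pow_four hh hX hind ht h4 l
    exact hcent _ ((measurable_proj hh _ l _).comp (hX (t l))) hp (hp4.trans hM4)
  have hR : Integrable (fun ω =>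
      residual h (fun j => μ.map (X j)) t (fun j => X (t j) ω) ^ 2) μ :=
    ((memLp_residual hh hX hind ht h4).mono_exponent
      (by norm_num : (2 : ENNReal) ≤ 4)).integrable_sq
  have hS : Integrable (fun ω => ∑ l,
      centeredProj h (fun j => μ.map (X j)) t l (X (t l) ω) ^ 2) μ :=
    integrable_finsetSum _ fun l _ => (hl l).1
  calc _ ≤ ∫ ω, (2 * (h (fun j => X (t j) ω) - θ) ^ 2 + 2 * (k + 1 : ℝ) * ∑ l,
      centeredProj h (fun j => μ.map (X j)) t l (X (t l) ω) ^ 2) ∂μ := by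
        refine integral_mono hR ((ha.const_mul 2).add (hS.const_mul _)) fun ω => ?_
        have hcs := sq_sum_le_card_mul_sum_sq (s := Finset.univ)
          (f := fun l => centeredProj h (fun j => μ.map (X j)) t l (X (t l) ω))
        simp only [Finset.card_univ, Fintype.card_fin, Nat.cast_add, Nat.cast_one] at hcs
        simp only [residual, ← hθdef]
        set A := h (fun j => X (t j) ω) - θ
        set B := ∑ l, centeredProj h (fun j => μ.map (X j)) t l (X (t l) ω)
        -- The residual is `A - B`, so `(A - B)² ≤ 2 A² + 2 B²`; `B²` is already bounded by
        -- Cauchy-Schwarz over the `k + 1` positions.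
        nlinarith [sq_nonneg (A + B)]
    _ = 2 * ∫ ω, (h (fun j => X (t j) ω) - θ) ^ 2 ∂μ + 2 * (k + 1 : ℝ) * ∑ l,
      ∫ ω, centeredProj h (fun j => μ.map (X j)) t l (X (t l) ω) ^ 2 ∂μ := by
        rw [integral_add (ha.const_mul 2) (hS.const_mul _), integral_const_mul,
          integral_const_mul, integral_finsetSum _ fun l _ => (hl l).1]
    _ ≤ 2 * (4 * M ^ (1 / 2 : ℝ)) + 2 * (k + 1 : ℝ) * ∑ _l : Fin (k + 1),
          4 * M ^ (1 / 2 : ℝ) := by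
        have := Finset.sum_le_sum fun l (_ : l ∈ Finset.univ) => (hl l).2
        gcongr
    _ = _ := by simp; ring

/-- The residual for `t` is orthogonal to every function of variables that share at most the
index `t l` with `t`. -/
theorem integral_residual_mul_eq_zero
    (hh : Measurable h) (hX : ∀ i, Measurable (X i)) (hind : iIndepFun X μ)
    (ht : Function.Injective t) (h4 : Integrable (fun ω => h (fun j => X (t j) ω) ^ 4) μ)
    (l : Fin (k + 1)) (S : Finset (Fin n)) (hl : t l ∈ S)
    (hS : ∀ j, t (l.succAbove j) ∉ S) {Γ : (S → 𝓧) → ℝ} (hΓ : Measurable Γ)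
    (hi : Integrable (fun ω => residual h (fun j => μ.map (X j)) t (fun j => X (t j) ω) *
      Γ (fun i => X i ω)) μ) :
    ∫ ω, residual h (fun j => μ.map (X j)) t (fun j => X (t j) ω) * Γ (fun i => X i ω) ∂μ
      = 0 := by
  have := fun i => Measure.isProbabilityMeasure_map (μ := μ) (hX i).aemeasurable
  have hY : Measurable fun ω j => X (t (Fin.succAbove l j)) ω := by fun_prop
  have := Measure.isProbabilityMeasure_map (μ := μ) hY.aemeasurable
  have hW : Measurable fun ω (i : S) => X i ω := by fun_prop
  have hI := indepFun_restrict_tuple hX hind S (fun j => t (l.succAbove j)) hS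
  have hins : Measurable fun p : (S → 𝓧) × (Fin k → 𝓧) =>
      (l.insertNth (p.1 ⟨t l, hl⟩) p.2 : Fin (k + 1) → 𝓧) :=
    (measurable_insertNth l).comp (f := fun p : (S → 𝓧) × (Fin k → 𝓧) => (p.1 ⟨t l, hl⟩, p.2))
      (by fun_prop)
  have hΦ : Measurable fun p : (S → 𝓧) × (Fin k → 𝓧) =>
      residual h (fun j => μ.map (X j)) t (l.insertNth (p.1 ⟨t l, hl⟩) p.2) * Γ p.1 :=
    ((measurable_residual hh _ t).comp hins).mul (hΓ.comp measurable_fst)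
  have hcongr : ∀ ω, residual h (fun j => μ.map (X j)) t (fun j => X (t j) ω) *
      Γ (fun i => X i ω) = residual h (fun j => μ.map (X j)) t
        (l.insertNth (X (t l) ω) fun j => X (t (l.succAbove j)) ω) * Γ (fun i => X i ω) := by
    intro ω
    rw [insertNth_tuple l fun i => X i ω]
  simp_rw [hcongr] at hi ⊢
  refine (IndepFun.integral_eq_integral_integral hW hY hI hΦ hi).trans ?_
  have hk : Integrable (fun ω => (h ∘ fun p : 𝓧 × (Fin k → 𝓧) =>
      (l.insertNth p.1 p.2 : Fin (k + 1) → 𝓧)) (X (t l) ω, fun j => X (t (l.succAbove j)) ω)) μ := by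
    refine (integrable_kernel hh hX h4).congr (Eventually.of_forall fun ω => ?_)
    exact congrArg h (insertNth_tuple l fun i => X i ω).symm
  -- With the variables in `S` frozen, `Γ` is a constant. Averaging the residual over the other
  -- entries turns the kernel into its projection at `t l`, kills the other centred projections, and
  -- the remaining terms cancel.
  refine integral_eq_zero_of_ae ?_
  filter_upwards [IndepFun.ae_integrable (hX _) hY (indepFun_coordinate_tuple hX hind ht l)
    (hh.comp (measurable_insertNth l)) hk] with ω hω
  have hω' : Integrable (fun y => h (l.insertNth (X (t l) ω) y))
      (μ.map fun ω j => X (t (l.succAbove j)) ω) := hω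
  simp only [Pi.zero_apply]
  rw [integral_mul_const]
  convert zero_mul _
  have hcm : ∀ j, Measurable fun y : Fin k → 𝓧 =>
      centeredProj h (fun j => μ.map (X j)) t (l.succAbove j) (y j) := fun j =>
    (measurable_centeredProj hh _ t _).comp (measurable_pi_apply j)
  have hci : ∀ j, Integrable (fun y : Fin k → 𝓧 =>
      centeredProj h (fun j => μ.map (X j)) t (l.succAbove j) (y j))
      (μ.map fun ω j => X (t (l.succAbove j)) ω) := fun j => by
    rw [integrable_map_measure (hcm j).aestronglyMeasurable hY.aemeasurable]
    exact (memLp_centeredProj hh hX hind ht h4 (l.succAbove j)).integrable (by norm_num)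
  have hc0 : ∀ j, ∫ y : Fin k → 𝓧,
      centeredProj h (fun j => μ.map (X j)) t (l.succAbove j) (y j)
      ∂(μ.map fun ω j => X (t (l.succAbove j)) ω) = 0 := fun j => by
    rw [integral_map hY.aemeasurable (hcm j).aestronglyMeasurable]
    exact integral_centeredProj hh hX hind ht h4 (l.succAbove j)
  have hsum : ∀ y : Fin k → 𝓧, residual h (fun j => μ.map (X j)) t
      (l.insertNth (X (t l) ω) y) = (h (l.insertNth (X (t l) ω) y) -
        (theta h (fun j => μ.map (X j)) t +
          centeredProj h (fun j => μ.map (X j)) t l (X (t l) ω))) -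
        ∑ j, centeredProj h (fun j => μ.map (X j)) t (l.succAbove j) (y j) := by
    intro y
    unfold residual
    rw [Fin.sum_univ_succAbove _ l]
    simp only [Fin.insertNth_apply_same, Fin.insertNth_apply_succAbove]
    ring
  simp_rw [hsum]
  have hA : Integrable (fun y => h (l.insertNth (X (t l) ω) y) -
        (theta h (fun j => μ.map (X j)) t +
          centeredProj h (fun j => μ.map (X j)) t l (X (t l) ω)))
      (μ.map fun ω j => X (t (l.succAbove j)) ω) := hω'.sub (integrable_const _)
  rw [integral_sub hA (integrable_finsetSum _ fun j _ => hci j),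
    integral_sub hω' (integrable_const _), integral_finsetSum _ fun j _ => hci j,
    Finset.sum_eq_zero fun j _ => hc0 j, ← proj_eq_integral_map hX hind ht l, integral_const]
  simp [centeredProj]

end

end Residual

end WeightedU

/-! ### Moment bounds for the remainder and for the linear terms. -/

namespace WeightedU

variable {𝓧 : Type*} [MeasurableSpace 𝓧] {Ω : Type*} [MeasurableSpace Ω] {μ : Measure Ω}
  {n k : ℕ} {h : (Fin (k + 1) → 𝓧) → ℝ} {X : Fin n → Ω → 𝓧}

/-- The contribution of the `i`-th variable to the Hájek projection of the U-statistic. -/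
noncomputable def linearTerm (a : (Fin (k + 1) → Fin n) → ℝ) (h : (Fin (k + 1) → 𝓧) → ℝ)
    (μ : Measure Ω) (X : Fin n → Ω → 𝓧) (i : Fin n) (ω : Ω) : ℝ :=
  (n : ℝ)⁻¹ * firstOrder a h (fun j => μ.map (X j)) i (X i ω)

/-- The difference of the centred U-statistic and its Hájek projection. -/
noncomputable def remainder (a : (Fin (k + 1) → Fin n) → ℝ) (h : (Fin (k + 1) → 𝓧) → ℝ)
    (μ : Measure Ω) (X : Fin n → Ω → 𝓧) (ω : Ω) : ℝ :=
  normalizer n (k + 1) * ∑ t ∈ indexSet n (k + 1),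
    a t * residual h (fun j => μ.map (X j)) t (fun j => X (t j) ω)

theorem card_commonIndices_le {m K : ℕ} (t : Fin (K + 1) → Fin m → Fin n) :
    (commonIndices t).card ≤ m := by
  have : commonIndices t ⊆ Finset.univ.image (t 0) := by
    intro i hi
    simp only [commonIndices, Finset.mem_filter, Finset.mem_univ, true_and] at hi
    obtain ⟨j, hj⟩ := hi 0
    exact Finset.mem_image.mpr ⟨j, Finset.mem_univ _, hj⟩
  refine (Finset.card_le_card this).trans (Finset.card_image_le.trans ?_)
  simp

theorem mem_piFinset_indexSet {m K : ℕ} {τ : Fin K → Fin m → Fin n} :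
    τ ∈ Fintype.piFinset (fun _ => indexSet n m) ↔ ∀ j, τ j ∈ indexSet n m := by
  simp

/-- If `s` and `t` share at most one index, then for a suitable `l` the index `t l` is the only one
that can be shared. -/
theorem exists_forall_succAbove_ne {s t : Fin (k + 1) → Fin n} (ht : Function.Injective t)
    (hst : (commonIndices ![s, t]).card < 2) :
    ∃ l : Fin (k + 1), ∀ j i, t (l.succAbove j) ≠ s i := by
  by_cases hc : ∃ l i, t l = s i
  · obtain ⟨l, i, hli⟩ := hc
    refine ⟨l, fun j i' hj => ?_⟩
    have hm1 : t l ∈ commonIndices ![s, t] := by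
      simp only [commonIndices, Finset.mem_filter, Finset.mem_univ, true_and, Fin.forall_fin_two]
      exact ⟨⟨i, hli.symm⟩, ⟨l, rfl⟩⟩
    have hm2 : t (l.succAbove j) ∈ commonIndices ![s, t] := by
      simp only [commonIndices, Finset.mem_filter, Finset.mem_univ, true_and, Fin.forall_fin_two]
      exact ⟨⟨i', hj.symm⟩, ⟨_, rfl⟩⟩
    have : 1 < (commonIndices ![s, t]).card :=
      Finset.one_lt_card.mpr ⟨_, hm1, _, hm2, fun e => Fin.succAbove_ne l j (ht e).symm⟩
    omega
  · push Not at hc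
    exact ⟨0, fun j i => hc _ _⟩

section

variable [IsProbabilityMeasure μ] {M : ℝ} (a : (Fin (k + 1) → Fin n) → ℝ)

theorem measurable_projAt
    (hh : Measurable h) (hX : ∀ i, Measurable (X i))
    (i : Fin n) (t : Fin (k + 1) → Fin n) :
    Measurable (projAt h (fun j => μ.map (X j)) i t) := by
  have := fun i => Measure.isProbabilityMeasure_map (μ := μ) (hX i).aemeasurable
  unfold projAt
  refine Finset.measurable_sum _ fun l _ => ?_
  split_ifs
  · exact measurable_centeredProj hh _ t l
  · exact measurable_const

theorem measurable_firstOrder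
    (hh : Measurable h) (hX : ∀ i, Measurable (X i))
    (i : Fin n) :
    Measurable fun x => (n : ℝ)⁻¹ * firstOrder a h (fun j => μ.map (X j)) i x := by
  simp_rw [inv_mul_firstOrder]
  exact (Finset.measurable_sum _ fun t _ =>
    (measurable_projAt hh hX i t).const_mul _).const_mul _

theorem measurable_linearTerm
    (hh : Measurable h) (hX : ∀ i, Measurable (X i))
    (i : Fin n) : Measurable (linearTerm a h μ X i) :=
  (measurable_firstOrder a hh hX i).comp (hX i)

theorem measurable_remainder
    (hh : Measurable h) (hX : ∀ i, Measurable (X i)) :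
    Measurable (remainder a h μ X) := by
  have := fun i => Measure.isProbabilityMeasure_map (μ := μ) (hX i).aemeasurable
  refine (Finset.measurable_sum _ fun t _ => ?_).const_mul _
  exact ((measurable_residual hh _ t).comp (by fun_prop)).const_mul _

theorem iIndepFun_linearTerm
    (hh : Measurable h) (hX : ∀ i, Measurable (X i)) (hind : iIndepFun X μ) :
    iIndepFun (linearTerm a h μ X) μ :=
  hind.comp (fun i x => (n : ℝ)⁻¹ * firstOrder a h (fun j => μ.map (X j)) i x)
    fun i => measurable_firstOrder a hh hX i

theorem memLp_projAt
    (hh : Measurable h) (hX : ∀ i, Measurable (X i)) (hind : iIndepFun X μ)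
    (hmom : ∀ t ∈ indexSet n (k + 1), Integrable (fun ω => h (fun j => X (t j) ω) ^ 4) μ ∧
      ∫ ω, h (fun j => X (t j) ω) ^ 4 ∂μ ≤ M)
    (i : Fin n) {t : Fin (k + 1) → Fin n} (ht : t ∈ indexSet n (k + 1)) :
    MemLp (fun ω => projAt h (fun j => μ.map (X j)) i t (X i ω)) 4 μ := by
  have hinj := mem_indexSet.mp ht
  by_cases hi : ∃ l, t l = i
  · obtain ⟨l, rfl⟩ := hi
    simp_rw [projAt_apply h _ hinj]
    exact memLp_centeredProj hh hX hind hinj (hmom t ht).1 l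
  · push Not at hi
    simp_rw [projAt_of_notMem h _ hi]
    exact memLp_const 0

theorem integral_projAt
    (hh : Measurable h) (hX : ∀ i, Measurable (X i)) (hind : iIndepFun X μ)
    (hmom : ∀ t ∈ indexSet n (k + 1), Integrable (fun ω => h (fun j => X (t j) ω) ^ 4) μ ∧
      ∫ ω, h (fun j => X (t j) ω) ^ 4 ∂μ ≤ M)
    (i : Fin n) {t : Fin (k + 1) → Fin n} (ht : t ∈ indexSet n (k + 1)) :
    ∫ ω, projAt h (fun j => μ.map (X j)) i t (X i ω) ∂μ = 0 := by
  have hinj := mem_indexSet.mp ht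
  by_cases hi : ∃ l, t l = i
  · obtain ⟨l, rfl⟩ := hi
    simp_rw [projAt_apply h _ hinj]
    exact integral_centeredProj hh hX hind hinj (hmom t ht).1 l
  · push Not at hi
    simp_rw [projAt_of_notMem h _ hi]
    simp

theorem integral_abs_cube_projAt_le
    (hh : Measurable h) (hX : ∀ i, Measurable (X i)) (hind : iIndepFun X μ)
    (hmom : ∀ t ∈ indexSet n (k + 1), Integrable (fun ω => h (fun j => X (t j) ω) ^ 4) μ ∧
      ∫ ω, h (fun j => X (t j) ω) ^ 4 ∂μ ≤ M)
    (hM : 0 < M) (i : Fin n) {t : Fin (k + 1) → Fin n}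
    (ht : t ∈ indexSet n (k + 1)) :
    ∫ ω, |projAt h (fun j => μ.map (X j)) i t (X i ω)| ^ 3 ∂μ ≤ 16 * M ^ (3 / 4 : ℝ) := by
  have hinj := mem_indexSet.mp ht
  by_cases hi : ∃ l, t l = i
  · obtain ⟨l, rfl⟩ := hi
    simp_rw [projAt_apply h _ hinj]
    exact integral_abs_cube_centeredProj_le hh hX hind hinj (hmom t ht).1 hM (hmom t ht).2 l
  · push Not at hi
    simp_rw [projAt_of_notMem h _ hi]
    have : 0 < M ^ (3 / 4 : ℝ) := Real.rpow_pos_of_pos hM _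
    simp
    positivity

theorem memLp_linearTerm
    (hh : Measurable h) (hX : ∀ i, Measurable (X i)) (hind : iIndepFun X μ)
    (hmom : ∀ t ∈ indexSet n (k + 1), Integrable (fun ω => h (fun j => X (t j) ω) ^ 4) μ ∧
      ∫ ω, h (fun j => X (t j) ω) ^ 4 ∂μ ≤ M)
    (i : Fin n) : MemLp (linearTerm a h μ X i) 4 μ := by
  unfold linearTerm
  simp_rw [inv_mul_firstOrder]
  exact (memLp_finsetSum _ fun t ht =>
    (memLp_projAt hh hX hind hmom i ht).const_mul _).const_mul _

theorem integral_linearTerm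
    (hh : Measurable h) (hX : ∀ i, Measurable (X i)) (hind : iIndepFun X μ)
    (hmom : ∀ t ∈ indexSet n (k + 1), Integrable (fun ω => h (fun j => X (t j) ω) ^ 4) μ ∧
      ∫ ω, h (fun j => X (t j) ω) ^ 4 ∂μ ≤ M)
    (i : Fin n) : ∫ ω, linearTerm a h μ X i ω ∂μ = 0 := by
  unfold linearTerm
  simp_rw [inv_mul_firstOrder]
  rw [integral_const_mul, integral_finsetSum _ fun t ht =>
    ((memLp_projAt hh hX hind hmom i ht).integrable (by norm_num)).const_mul _]
  rw [Finset.sum_eq_zero fun t ht => ?_, mul_zero]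
  rw [integral_const_mul, integral_projAt hh hX hind hmom i ht, mul_zero]

theorem memLp_remainder
    (hh : Measurable h) (hX : ∀ i, Measurable (X i)) (hind : iIndepFun X μ)
    (hmom : ∀ t ∈ indexSet n (k + 1), Integrable (fun ω => h (fun j => X (t j) ω) ^ 4) μ ∧
      ∫ ω, h (fun j => X (t j) ω) ^ 4 ∂μ ≤ M) :
    MemLp (remainder a h μ X) 4 μ :=
  (memLp_finsetSum _ fun t ht => (memLp_residual hh hX hind (mem_indexSet.mp ht)
    (hmom t ht).1).const_mul _).const_mul _

/-- Orthogonality with `S = {t l, i}`, where `l` is chosen so that no other entry of `t` equals `i`.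
Taking `φ = 1` shows that residuals are centred; taking `φ` to be a linear term makes the remainder
orthogonal to the Hájek projection. -/
theorem integral_residual_mul_coordinate
    (hh : Measurable h) (hX : ∀ i, Measurable (X i)) (hind : iIndepFun X μ)
    (hmom : ∀ t ∈ indexSet n (k + 1), Integrable (fun ω => h (fun j => X (t j) ω) ^ 4) μ ∧
      ∫ ω, h (fun j => X (t j) ω) ^ 4 ∂μ ≤ M)
    {t : Fin (k + 1) → Fin n}
    (ht : t ∈ indexSet n (k + 1)) (i : Fin n) {φ : 𝓧 → ℝ} (hφ : Measurable φ)
    (hφL : MemLp (fun ω => φ (X i ω)) 2 μ) :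
    ∫ ω, residual h (fun j => μ.map (X j)) t (fun j => X (t j) ω) * φ (X i ω) ∂μ = 0 := by
  have hinj := mem_indexSet.mp ht
  obtain ⟨l, hl⟩ : ∃ l : Fin (k + 1), ∀ j, t (l.succAbove j) ≠ i := by
    by_cases hi : ∃ l, t l = i
    · obtain ⟨l, rfl⟩ := hi
      exact ⟨l, fun j e => Fin.succAbove_ne l j (hinj e)⟩
    · push Not at hi
      exact ⟨0, fun j => hi _⟩
  have hR := (memLp_residual hh hX hind hinj (hmom t ht).1).mono_exponent
    (by norm_num : (2 : ENNReal) ≤ 4)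
  refine integral_residual_mul_eq_zero hh hX hind hinj (hmom t ht).1 l {t l, i} (by simp)
    (fun j => ?_) (Γ := fun w => φ (w ⟨i, by simp⟩)) (by fun_prop) (hR.integrable_mul hφL)
  simp only [Finset.mem_insert, Finset.mem_singleton, not_or]
  exact ⟨fun e => Fin.succAbove_ne l j (hinj e), hl j⟩

theorem integral_residual_mul_residual
    (hh : Measurable h) (hX : ∀ i, Measurable (X i)) (hind : iIndepFun X μ)
    (hmom : ∀ t ∈ indexSet n (k + 1), Integrable (fun ω => h (fun j => X (t j) ω) ^ 4) μ ∧
      ∫ ω, h (fun j => X (t j) ω) ^ 4 ∂μ ≤ M)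
    {s t : Fin (k + 1) → Fin n}
    (hs : s ∈ indexSet n (k + 1)) (ht : t ∈ indexSet n (k + 1))
    (hst : (commonIndices ![s, t]).card < 2) :
    ∫ ω, residual h (fun j => μ.map (X j)) t (fun j => X (t j) ω) *
      residual h (fun j => μ.map (X j)) s (fun j => X (s j) ω) ∂μ = 0 := by
  classical
  have := fun i => Measure.isProbabilityMeasure_map (μ := μ) (hX i).aemeasurable
  have hinj := mem_indexSet.mp ht
  obtain ⟨l, hl⟩ := exists_forall_succAbove_ne hinj hst
  have hR := (memLp_residual hh hX hind hinj (hmom t ht).1).mono_exponent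
    (by norm_num : (2 : ENNReal) ≤ 4)
  have hR' := (memLp_residual hh hX hind (mem_indexSet.mp hs) (hmom s hs).1).mono_exponent
    (by norm_num : (2 : ENNReal) ≤ 4)
  refine integral_residual_mul_eq_zero hh hX hind hinj (hmom t ht).1 l
    (insert (t l) (Finset.univ.image s)) (by simp) (fun j => ?_)
    (Γ := fun w => residual h (fun j => μ.map (X j)) s fun j => w ⟨s j, by simp⟩)
    ((measurable_residual hh _ s).comp (by fun_prop)) (hR.integrable_mul hR')
  simp only [Finset.mem_insert, Finset.mem_image, Finset.mem_univ, true_and, not_or, not_exists]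
  exact ⟨fun e => Fin.succAbove_ne l j (hinj e), fun i e => hl j i e.symm⟩

theorem integral_remainder
    (hh : Measurable h) (hX : ∀ i, Measurable (X i)) (hind : iIndepFun X μ)
    (hmom : ∀ t ∈ indexSet n (k + 1), Integrable (fun ω => h (fun j => X (t j) ω) ^ 4) μ ∧
      ∫ ω, h (fun j => X (t j) ω) ^ 4 ∂μ ≤ M) :
    ∫ ω, remainder a h μ X ω ∂μ = 0 := by
  unfold remainder
  rw [integral_const_mul, integral_finsetSum _ fun t ht =>
    ((memLp_residual hh hX hind (mem_indexSet.mp ht) (hmom t ht).1).integrable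
      (by norm_num)).const_mul _]
  rw [Finset.sum_eq_zero fun t ht => ?_, mul_zero]
  rw [integral_const_mul]
  have := integral_residual_mul_coordinate hh hX hind hmom ht (t 0) (φ := fun _ => 1)
    measurable_const (memLp_const 1)
  simp only [mul_one] at this
  rw [this, mul_zero]

theorem integral_remainder_mul_linearTerm
    (hh : Measurable h) (hX : ∀ i, Measurable (X i)) (hind : iIndepFun X μ)
    (hmom : ∀ t ∈ indexSet n (k + 1), Integrable (fun ω => h (fun j => X (t j) ω) ^ 4) μ ∧
      ∫ ω, h (fun j => X (t j) ω) ^ 4 ∂μ ≤ M)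
    (i : Fin n) :
    ∫ ω, remainder a h μ X ω * linearTerm a h μ X i ω ∂μ = 0 := by
  have hL := (memLp_linearTerm a hh hX hind hmom i).mono_exponent
    (by norm_num : (2 : ENNReal) ≤ 4)
  have hR : ∀ t ∈ indexSet n (k + 1), Integrable (fun ω =>
      residual h (fun j => μ.map (X j)) t (fun j => X (t j) ω) * linearTerm a h μ X i ω) μ :=
    fun t ht => ((memLp_residual hh hX hind (mem_indexSet.mp ht) (hmom t ht).1).mono_exponent
      (by norm_num : (2 : ENNReal) ≤ 4)).integrable_mul hL
  unfold remainder
  simp_rw [mul_assoc, Finset.sum_mul, mul_assoc]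
  rw [integral_const_mul, integral_finsetSum _ fun t ht => (hR t ht).const_mul _]
  rw [Finset.sum_eq_zero fun t ht => ?_, mul_zero]
  have h0 : ∫ ω, residual h (fun j => μ.map (X j)) t (fun j => X (t j) ω) *
      linearTerm a h μ X i ω ∂μ = 0 :=
    integral_residual_mul_coordinate hh hX hind hmom ht i (measurable_firstOrder a hh hX i) hL
  rw [integral_const_mul, h0, mul_zero]

/-- The square expands over pairs of tuples. Pairs sharing fewer than two indices integrate to zero,
and the others form exactly the set over which `A_{2,2}` averages. -/
theorem integral_sq_remainder_le
    (hh : Measurable h) (hX : ∀ i, Measurable (X i)) (hind : iIndepFun X μ)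
    (hmom : ∀ t ∈ indexSet n (k + 1), Integrable (fun ω => h (fun j => X (t j) ω) ^ 4) μ ∧
      ∫ ω, h (fun j => X (t j) ω) ^ 4 ∂μ ≤ M)
    (hM : 0 < M) :
    ∫ ω, remainder a h μ X ω ^ 2 ∂μ ≤ (8 + 8 * (k + 1 : ℝ) ^ 2) * M ^ (1 / 2 : ℝ) *
      (normalizer n (k + 1) ^ 2 * (sharingSet n (k + 1) 2 2).card) * avgWeight a 2 2 := by
  set R : (Fin (k + 1) → Fin n) → Ω → ℝ := fun t ω =>
    residual h (fun j => μ.map (X j)) t (fun j => X (t j) ω) with hRdef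
  set B := (8 + 8 * (k + 1 : ℝ) ^ 2) * M ^ (1 / 2 : ℝ)
  have hB : 0 < B := by
    have : 0 < M ^ (1 / 2 : ℝ) := Real.rpow_pos_of_pos hM _
    positivity
  have hL : ∀ t ∈ indexSet n (k + 1), MemLp (R t) 2 μ := fun t ht =>
    (memLp_residual hh hX hind (mem_indexSet.mp ht) (hmom t ht).1).mono_exponent
      (by norm_num : (2 : ENNReal) ≤ 4)
  have hexp : ∀ ω, remainder a h μ X ω ^ 2 = normalizer n (k + 1) ^ 2 *
      ∑ τ ∈ Fintype.piFinset (fun _ : Fin 2 => indexSet n (k + 1)),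
        (∏ j, a (τ j)) * (R (τ 0) ω * R (τ 1) ω) := by
    intro ω
    unfold remainder
    rw [mul_pow, Finset.sum_pow']
    congr 1
    refine Finset.sum_congr rfl fun τ _ => ?_
    simp only [Fin.prod_univ_two, hRdef]
    ring
  simp_rw [hexp]
  rw [integral_const_mul, integral_finsetSum]
  swap
  · intro τ hτ
    rw [mem_piFinset_indexSet] at hτ
    exact ((hL _ (hτ 0)).integrable_mul (hL _ (hτ 1))).const_mul _
  have hterm : ∀ τ ∈ Fintype.piFinset (fun _ : Fin 2 => indexSet n (k + 1)),
      ∫ ω, (∏ j, a (τ j)) * (R (τ 0) ω * R (τ 1) ω) ∂μ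
        ≤ if 2 ≤ (commonIndices τ).card then B * |∏ j, a (τ j)| else 0 := by
    intro τ hτ
    rw [mem_piFinset_indexSet] at hτ
    rw [integral_const_mul]
    split_ifs with hc
    · have h0 := (hL _ (hτ 0)).integrable_sq
      have h1 := (hL _ (hτ 1)).integrable_sq
      have hi := (hL _ (hτ 0)).integrable_mul (hL _ (hτ 1))
      have hb : |∫ ω, R (τ 0) ω * R (τ 1) ω ∂μ| ≤ B := by
        refine (abs_integral_le_integral_abs).trans ?_
        have hle : ∫ ω, |R (τ 0) ω * R (τ 1) ω| ∂μ
            ≤ ∫ ω, (R (τ 0) ω ^ 2 + R (τ 1) ω ^ 2) / 2 ∂μ := by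
          refine integral_mono hi.abs ((h0.add h1).div_const 2) fun ω => ?_
          change |R (τ 0) ω * R (τ 1) ω| ≤ (R (τ 0) ω ^ 2 + R (τ 1) ω ^ 2) / 2
          rw [abs_mul, ← sq_abs (R (τ 0) ω), ← sq_abs (R (τ 1) ω)]
          nlinarith [sq_nonneg (|R (τ 0) ω| - |R (τ 1) ω|)]
        rw [integral_div, integral_add h0 h1] at hle
        have e0 := integral_sq_residual_le hh hX hind (mem_indexSet.mp (hτ 0))
          (hmom _ (hτ 0)).1 hM (hmom _ (hτ 0)).2
        have e1 := integral_sq_residual_le hh hX hind (mem_indexSet.mp (hτ 1))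
          (hmom _ (hτ 1)).1 hM (hmom _ (hτ 1)).2
        linarith
      refine (le_abs_self _).trans ?_
      rw [abs_mul, mul_comm]
      exact mul_le_mul_of_nonneg_right hb (abs_nonneg _)
    -- The orthogonality lemma expects the pair in reverse order, which has the same common indices.
    · have hτ' : ![τ 1, τ 0] = fun j => τ (Fin.rev j) := by
        funext j; fin_cases j <;> rfl
      have hc' : commonIndices ![τ 1, τ 0] = commonIndices τ := by
        rw [hτ']
        ext i
        simp only [commonIndices, Finset.mem_filter, Finset.mem_univ, true_and,
          Fin.forall_fin_two]
        exact and_comm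
      rw [show ∫ ω, R (τ 0) ω * R (τ 1) ω ∂μ = 0 from
        integral_residual_mul_residual hh hX hind hmom (hτ 1) (hτ 0) (by rw [hc']; omega),
        mul_zero]
  have hset : (Fintype.piFinset (fun _ : Fin 2 => indexSet n (k + 1))).filter
      (fun τ => 2 ≤ (commonIndices τ).card) = sharingSet n (k + 1) 2 2 := by
    ext τ
    simp only [Finset.mem_filter, mem_piFinset_indexSet, sharingSet, Finset.mem_univ, true_and]
  calc _ ≤ normalizer n (k + 1) ^ 2 *
        ∑ τ ∈ Fintype.piFinset (fun _ : Fin 2 => indexSet n (k + 1)),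
          (if 2 ≤ (commonIndices τ).card then B * |∏ j, a (τ j)| else 0) :=
        mul_le_mul_of_nonneg_left (Finset.sum_le_sum hterm) (sq_nonneg _)
    _ = _ := by
        rw [← Finset.sum_filter, hset, ← Finset.mul_sum, sum_sharingSet_eq]
        ring

/-- The cube expands over triples of tuples, and a triple contributes to the `i`-th term only if `i`
lies in all three. Summed over `i`, a triple is counted once for each common index, hence at most `k
+ 1` times. The constant is `48 = 3 · 16`. -/
theorem sum_integral_abs_cube_linearTerm_le
    (hh : Measurable h) (hX : ∀ i, Measurable (X i)) (hind : iIndepFun X μ)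
    (hmom : ∀ t ∈ indexSet n (k + 1), Integrable (fun ω => h (fun j => X (t j) ω) ^ 4) μ ∧
      ∫ ω, h (fun j => X (t j) ω) ^ 4 ∂μ ≤ M)
    (hM : 0 < M) :
    ∑ i, ∫ ω, |linearTerm a h μ X i ω| ^ 3 ∂μ ≤ (k + 1 : ℝ) * (48 * M ^ (3 / 4 : ℝ)) *
      (normalizer n (k + 1) ^ 3 * (sharingSet n (k + 1) 3 1).card) * avgWeight a 3 1 := by
  set G : Fin n → (Fin (k + 1) → Fin n) → Ω → ℝ := fun i t ω =>
    projAt h (fun j => μ.map (X j)) i t (X i ω) with hG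
  set B := 48 * M ^ (3 / 4 : ℝ) with hBdef
  have hB : 0 < B := by
    have : 0 < M ^ (3 / 4 : ℝ) := Real.rpow_pos_of_pos hM _
    positivity
  have hL : ∀ i, ∀ t ∈ indexSet n (k + 1), Integrable (fun ω => |G i t ω| ^ 3) μ := fun i t ht =>
    integrable_abs_pow_of_memLp (p := 3) (by norm_num)
      ((memLp_projAt hh hX hind hmom i ht).mono_exponent (by norm_num))
  have hprod : ∀ x y z : ℝ, 0 ≤ x → 0 ≤ y → 0 ≤ z → x * y * z ≤ x ^ 3 + y ^ 3 + z ^ 3 := by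
    intro x y z hx hy hz
    have h1 : 0 ≤ x * (y - z) ^ 2 := by positivity
    have h2 : 0 ≤ y * (x - z) ^ 2 := by positivity
    have h3 : 0 ≤ z * (x - y) ^ 2 := by positivity
    have h4 : 0 ≤ (x + y + z) * ((x - y) ^ 2 + (y - z) ^ 2 + (x - z) ^ 2) := by positivity
    have h5 : 0 ≤ x * y * z := by positivity
    nlinarith
  have hpt : ∀ i ω, |linearTerm a h μ X i ω| ^ 3 ≤ normalizer n (k + 1) ^ 3 *
      ∑ τ ∈ Fintype.piFinset (fun _ : Fin 3 => indexSet n (k + 1)),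
        (if i ∈ commonIndices τ then |∏ j, a (τ j)| *
          (|G i (τ 0) ω| ^ 3 + |G i (τ 1) ω| ^ 3 + |G i (τ 2) ω| ^ 3) else 0) := by
    intro i ω
    have h1 : |linearTerm a h μ X i ω| ≤ normalizer n (k + 1) *
        ∑ t ∈ indexSet n (k + 1), |a t| * |G i t ω| := by
      unfold linearTerm
      rw [inv_mul_firstOrder, abs_mul, abs_of_nonneg (normalizer_nonneg _ _)]
      refine mul_le_mul_of_nonneg_left ((Finset.abs_sum_le_sum_abs _ _).trans (le_of_eq ?_))
        (normalizer_nonneg _ _)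
      exact Finset.sum_congr rfl fun t _ => abs_mul _ _
    refine (pow_le_pow_left₀ (abs_nonneg _) h1 3).trans ?_
    rw [mul_pow, Finset.sum_pow']
    refine mul_le_mul_of_nonneg_left (Finset.sum_le_sum fun τ _ => ?_)
      (pow_nonneg (normalizer_nonneg _ _) 3)
    rw [Finset.prod_mul_distrib, ← Finset.abs_prod]
    split_ifs with hi
    · refine mul_le_mul_of_nonneg_left ?_ (abs_nonneg _)
      rw [Fin.prod_univ_three]
      exact hprod _ _ _ (abs_nonneg _) (abs_nonneg _) (abs_nonneg _)
    · simp only [commonIndices, Finset.mem_filter, Finset.mem_univ, true_and, not_forall,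
        not_exists] at hi
      obtain ⟨j, hj⟩ := hi
      have : ∏ j, |G i (τ j) ω| = 0 :=
        Finset.prod_eq_zero (Finset.mem_univ j) (by
          simp only [hG]
          rw [projAt_of_notMem h _ hj, abs_zero])
      rw [this, mul_zero]
  have hsumi : ∀ i, ∀ τ ∈ Fintype.piFinset (fun _ : Fin 3 => indexSet n (k + 1)),
      Integrable (fun ω => if i ∈ commonIndices τ then |∏ j, a (τ j)| *
          (|G i (τ 0) ω| ^ 3 + |G i (τ 1) ω| ^ 3 + |G i (τ 2) ω| ^ 3) else 0) μ := by
    intro i τ hτ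
    rw [mem_piFinset_indexSet] at hτ
    split_ifs
    · exact (((hL i _ (hτ 0)).add (hL i _ (hτ 1))).add (hL i _ (hτ 2))).const_mul _
    · exact integrable_const 0
  have hint : ∀ i, ∫ ω, |linearTerm a h μ X i ω| ^ 3 ∂μ ≤ normalizer n (k + 1) ^ 3 *
      ∑ τ ∈ Fintype.piFinset (fun _ : Fin 3 => indexSet n (k + 1)),
        (if i ∈ commonIndices τ then B * |∏ j, a (τ j)| else 0) := by
    intro i
    have hLi : Integrable (fun ω => |linearTerm a h μ X i ω| ^ 3) μ :=
      integrable_abs_pow_of_memLp (p := 3) (by norm_num)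
        ((memLp_linearTerm a hh hX hind hmom i).mono_exponent (by norm_num))
    refine (integral_mono hLi ((integrable_finsetSum _ (hsumi i)).const_mul _) (hpt i)).trans ?_
    rw [integral_const_mul, integral_finsetSum _ (hsumi i)]
    refine mul_le_mul_of_nonneg_left (Finset.sum_le_sum fun τ hτ => ?_)
      (pow_nonneg (normalizer_nonneg _ _) 3)
    rw [mem_piFinset_indexSet] at hτ
    split_ifs
    · have h01 : Integrable (fun ω => |G i (τ 0) ω| ^ 3 + |G i (τ 1) ω| ^ 3) μ :=
        (hL i _ (hτ 0)).add (hL i _ (hτ 1))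
      rw [integral_const_mul, integral_add h01 (hL i _ (hτ 2)),
        integral_add (hL i _ (hτ 0)) (hL i _ (hτ 1)), mul_comm]
      refine mul_le_mul_of_nonneg_right ?_ (abs_nonneg _)
      have e0 := integral_abs_cube_projAt_le hh hX hind hmom hM i (hτ 0)
      have e1 := integral_abs_cube_projAt_le hh hX hind hmom hM i (hτ 1)
      have e2 := integral_abs_cube_projAt_le hh hX hind hmom hM i (hτ 2)
      linarith
    · simp
  have hset : (Fintype.piFinset (fun _ : Fin 3 => indexSet n (k + 1))).filter
      (fun τ => 1 ≤ (commonIndices τ).card) = sharingSet n (k + 1) 3 1 := by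
    ext τ
    simp only [Finset.mem_filter, mem_piFinset_indexSet, sharingSet, Finset.mem_univ, true_and]
  calc _ ≤ ∑ i, normalizer n (k + 1) ^ 3 *
        ∑ τ ∈ Fintype.piFinset (fun _ : Fin 3 => indexSet n (k + 1)),
          (if i ∈ commonIndices τ then B * |∏ j, a (τ j)| else 0) :=
        Finset.sum_le_sum fun i _ => hint i
    -- Exchanging the two sums turns the indicator into the number of common indices.
    _ = normalizer n (k + 1) ^ 3 *
        ∑ τ ∈ Fintype.piFinset (fun _ : Fin 3 => indexSet n (k + 1)),
          (commonIndices τ).card * (B * |∏ j, a (τ j)|) := by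
        rw [← Finset.mul_sum, Finset.sum_comm]
        congr 1
        refine Finset.sum_congr rfl fun τ _ => ?_
        rw [Finset.sum_ite_mem, Finset.univ_inter, Finset.sum_const, nsmul_eq_mul]
    _ ≤ normalizer n (k + 1) ^ 3 *
        ∑ τ ∈ Fintype.piFinset (fun _ : Fin 3 => indexSet n (k + 1)),
          (if 1 ≤ (commonIndices τ).card then (k + 1 : ℝ) * (B * |∏ j, a (τ j)|) else 0) := by
        refine mul_le_mul_of_nonneg_left (Finset.sum_le_sum fun τ _ => ?_)
          (pow_nonneg (normalizer_nonneg _ _) 3)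
        split_ifs with hc
        · refine mul_le_mul_of_nonneg_right ?_ (by positivity)
          exact_mod_cast card_commonIndices_le τ
        · rw [show (commonIndices τ).card = 0 by omega]; simp
    _ = _ := by
        rw [← Finset.sum_filter, hset, ← Finset.mul_sum, ← Finset.mul_sum, sum_sharingSet_eq]
        ring

end

end WeightedU

/-! ### Effect of adding an orthogonal remainder on standardization. -/

section Standardization

variable {Ω : Type*} [MeasurableSpace Ω] {μ : Measure Ω}

theorem integral_abs_le_sqrt_integral_sq [IsProbabilityMeasure μ] {f : Ω → ℝ} (hf : MemLp f 2 μ) :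
    ∫ ω, |f ω| ∂μ ≤ Real.sqrt (∫ ω, f ω ^ 2 ∂μ) := by
  refine Real.le_sqrt_of_sq_le ?_
  have h0 := variance_nonneg (fun ω => |f ω|) μ
  have hf' : MemLp (fun ω => |f ω|) 2 μ := hf.abs
  rw [variance_eq_sub hf'] at h0
  simp only [Pi.pow_apply, sq_abs] at h0
  linarith

variable {S D : Ω → ℝ}

theorem integral_sq_add_of_orthogonal (hS : MemLp S 2 μ) (hD : MemLp D 2 μ)
    (hDS : ∫ ω, D ω * S ω ∂μ = 0) (α β : ℝ) :
    ∫ ω, (α * S ω + β * D ω) ^ 2 ∂μ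
      = α ^ 2 * ∫ ω, S ω ^ 2 ∂μ + β ^ 2 * ∫ ω, D ω ^ 2 ∂μ := by
  have h1 := hS.integrable_sq.const_mul (α ^ 2)
  have h2 := hD.integrable_sq.const_mul (β ^ 2)
  have h3 : Integrable (fun ω => 2 * α * β * (D ω * S ω)) μ :=
    (hD.integrable_mul hS).const_mul _
  have h12 : Integrable (fun ω => α ^ 2 * S ω ^ 2 + β ^ 2 * D ω ^ 2) μ := h1.add h2
  have : ∀ ω, (α * S ω + β * D ω) ^ 2
      = (α ^ 2 * S ω ^ 2 + β ^ 2 * D ω ^ 2) + 2 * α * β * (D ω * S ω) := fun ω => by ring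
  simp_rw [this]
  rw [integral_add h12 h3, integral_add h1 h2, integral_const_mul, integral_const_mul,
    integral_const_mul, hDS]
  ring

/-- Standardizing `S + D` instead of `S` changes little when `D` is orthogonal to `S` and the
variances are close. -/
theorem integral_abs_standardized_sub_le [IsProbabilityMeasure μ] (hS : MemLp S 2 μ)
    (hD : MemLp D 2 μ)
    (hDS : ∫ ω, D ω * S ω ∂μ = 0) {V v : ℝ} (hV : V = ∫ ω, S ω ^ 2 ∂μ) (hV0 : 0 < V)
    (hv : v = V + ∫ ω, D ω ^ 2 ∂μ) :
    ∫ ω, |v ^ (-(1 / 2) : ℝ) * (S ω + D ω) - V ^ (-(1 / 2) : ℝ) * S ω| ∂μ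
      ≤ Real.sqrt (2 - 2 * (v / V) ^ (-(1 / 2) : ℝ)) := by
  have hE : 0 ≤ ∫ ω, D ω ^ 2 ∂μ := integral_nonneg fun ω => sq_nonneg _
  have hv0 : 0 < v := by linarith
  have hsq : ∀ x : ℝ, 0 < x → (x ^ (-(1 / 2) : ℝ)) ^ 2 * x = 1 := fun x hx => by
    rw [← Real.rpow_natCast, ← Real.rpow_mul hx.le]
    norm_num
    rw [Real.rpow_neg_one, inv_mul_cancel₀ hx.ne']
  have hdiv : (v / V) ^ (-(1 / 2) : ℝ) = v ^ (-(1 / 2) : ℝ) * (V ^ (-(1 / 2) : ℝ) * V) := by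
    rw [Real.div_rpow hv0.le hV0.le, div_eq_mul_inv, ← Real.rpow_neg hV0.le]
    congr 1
    nth_rewrite 3 [← Real.rpow_one V]
    rw [← Real.rpow_add hV0]; norm_num
  have h1 := hsq v hv0
  have h2 := hsq V hV0
  set α := v ^ (-(1 / 2) : ℝ)
  set β := V ^ (-(1 / 2) : ℝ)
  have hform : ∀ ω, α * (S ω + D ω) - β * S ω = (α - β) * S ω + α * D ω := fun ω => by ring
  simp_rw [hform]
  have hL : MemLp (fun ω => (α - β) * S ω + α * D ω) 2 μ := (hS.const_mul _).add (hD.const_mul _)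
  refine (integral_abs_le_sqrt_integral_sq hL).trans (Real.sqrt_le_sqrt (le_of_eq ?_))
  -- By orthogonality the second moment is `(α - β)² V + α² (v - V)`. Since `α² v = β² V = 1` it
  -- equals `2 - 2 α β V`, and `α β V = (v / V)^(-1/2)`.
  rw [integral_sq_add_of_orthogonal hS hD hDS, ← hV, hdiv]
  have : ∫ ω, D ω ^ 2 ∂μ = v - V := by linarith
  rw [this]
  linear_combination h1 + h2

end Standardization

/-! ### Variance identity, rates and the characteristic function bound. -/

namespace WeightedU

variable {𝓧 : Type*} [MeasurableSpace 𝓧] {Ω : Type*} [MeasurableSpace Ω] {μ : Measure Ω}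
  {n k : ℕ} {h : (Fin (k + 1) → 𝓧) → ℝ} {X : Fin n → Ω → 𝓧}

/-- The Hájek projection of the centred U-statistic. -/
noncomputable def linearPart (a : (Fin (k + 1) → Fin n) → ℝ) (h : (Fin (k + 1) → 𝓧) → ℝ)
    (μ : Measure Ω) (X : Fin n → Ω → 𝓧) (ω : Ω) : ℝ :=
  ∑ i, linearTerm a h μ X i ω

section

variable [IsProbabilityMeasure μ] {M : ℝ} (a : (Fin (k + 1) → Fin n) → ℝ)

theorem memLp_linearPart
    (hh : Measurable h) (hX : ∀ i, Measurable (X i)) (hind : iIndepFun X μ)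
    (hmom : ∀ t ∈ indexSet n (k + 1), Integrable (fun ω => h (fun j => X (t j) ω) ^ 4) μ ∧
      ∫ ω, h (fun j => X (t j) ω) ^ 4 ∂μ ≤ M) :
    MemLp (linearPart a h μ X) 2 μ :=
  memLp_finsetSum _ fun i _ => (memLp_linearTerm a hh hX hind hmom i).mono_exponent
    (by norm_num : (2 : ENNReal) ≤ 4)

theorem integral_linearPart
    (hh : Measurable h) (hX : ∀ i, Measurable (X i)) (hind : iIndepFun X μ)
    (hmom : ∀ t ∈ indexSet n (k + 1), Integrable (fun ω => h (fun j => X (t j) ω) ^ 4) μ ∧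
      ∫ ω, h (fun j => X (t j) ω) ^ 4 ∂μ ≤ M) :
    ∫ ω, linearPart a h μ X ω ∂μ = 0 := by
  unfold linearPart
  rw [integral_finsetSum _ fun i _ => (memLp_linearTerm a hh hX hind hmom i).integrable
    (by norm_num)]
  exact Finset.sum_eq_zero fun i _ => integral_linearTerm a hh hX hind hmom i

theorem integral_remainder_mul_linearPart
    (hh : Measurable h) (hX : ∀ i, Measurable (X i)) (hind : iIndepFun X μ)
    (hmom : ∀ t ∈ indexSet n (k + 1), Integrable (fun ω => h (fun j => X (t j) ω) ^ 4) μ ∧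
      ∫ ω, h (fun j => X (t j) ω) ^ 4 ∂μ ≤ M) :
    ∫ ω, remainder a h μ X ω * linearPart a h μ X ω ∂μ = 0 := by
  have hR := (memLp_remainder a hh hX hind hmom).mono_exponent (by norm_num : (2 : ENNReal) ≤ 4)
  have hi : ∀ i, Integrable (fun ω => remainder a h μ X ω * linearTerm a h μ X i ω) μ := fun i =>
    hR.integrable_mul
      ((memLp_linearTerm a hh hX hind hmom i).mono_exponent (by norm_num : (2 : ENNReal) ≤ 4))
  unfold linearPart
  simp_rw [Finset.mul_sum]
  rw [integral_finsetSum _ fun i _ => hi i]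
  exact Finset.sum_eq_zero fun i _ => integral_remainder_mul_linearTerm a hh hX hind hmom i

theorem mainVar_eq_integral_sq
    (hh : Measurable h) (hX : ∀ i, Measurable (X i)) (hind : iIndepFun X μ)
    (hmom : ∀ t ∈ indexSet n (k + 1), Integrable (fun ω => h (fun j => X (t j) ω) ^ 4) μ ∧
      ∫ ω, h (fun j => X (t j) ω) ^ 4 ∂μ ≤ M) :
    mainVar a h μ X = ∫ ω, linearPart a h μ X ω ^ 2 ∂μ := by
  unfold mainVar
  have : (fun ω => (n : ℝ)⁻¹ * ∑ i, firstOrder a h (fun j => μ.map (X j)) i (X i ω))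
      = linearPart a h μ X := by
    funext ω
    rw [Finset.mul_sum]
    rfl
  rw [this, variance_of_integral_eq_zero
    (memLp_linearPart a hh hX hind hmom).aestronglyMeasurable.aemeasurable
    (integral_linearPart a hh hX hind hmom)]

/-- Independence adds the variances. In this form `V` is the normalization required by the Lyapunov
bound. -/
theorem mainVar_eq_sum
    (hh : Measurable h) (hX : ∀ i, Measurable (X i)) (hind : iIndepFun X μ)
    (hmom : ∀ t ∈ indexSet n (k + 1), Integrable (fun ω => h (fun j => X (t j) ω) ^ 4) μ ∧
      ∫ ω, h (fun j => X (t j) ω) ^ 4 ∂μ ≤ M) :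
    mainVar a h μ X = ∑ i, ∫ ω, linearTerm a h μ X i ω ^ 2 ∂μ := by
  have hL := fun i => (memLp_linearTerm a hh hX hind hmom i).mono_exponent
    (by norm_num : (2 : ENNReal) ≤ 4)
  have hv : mainVar a h μ X = variance (∑ i, linearTerm a h μ X i) μ := by
    unfold mainVar
    congr 1
    funext ω
    rw [Finset.mul_sum, Finset.sum_apply]
    rfl
  rw [hv, IndepFun.variance_sum (fun i _ => hL i)
    fun i _ j _ hij => (iIndepFun_linearTerm a hh hX hind).indepFun hij]
  exact Finset.sum_congr rfl fun i _ => variance_of_integral_eq_zero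
    (hL i).aestronglyMeasurable.aemeasurable (integral_linearTerm a hh hX hind hmom i)

theorem uStat_sub_integral
    (hh : Measurable h) (hX : ∀ i, Measurable (X i)) (hind : iIndepFun X μ)
    (hmom : ∀ t ∈ indexSet n (k + 1), Integrable (fun ω => h (fun j => X (t j) ω) ^ 4) μ ∧
      ∫ ω, h (fun j => X (t j) ω) ^ 4 ∂μ ≤ M)
    (ω : Ω) :
    uStat a h (fun i => X i ω) - ∫ ω', uStat a h (fun i => X i ω') ∂μ
      = linearPart a h μ X ω + remainder a h μ X ω := by
  set c := normalizer n (k + 1) * ∑ t ∈ indexSet n (k + 1), a t * theta h (fun j => μ.map (X j)) t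
  have he : ∀ ω, uStat a h (fun i => X i ω)
      = c + linearPart a h μ X ω + remainder a h μ X ω := fun ω =>
    uStat_eq a h (fun j => μ.map (X j)) fun i => X i ω
  simp_rw [he]
  have hS := (memLp_linearPart a hh hX hind hmom).integrable (by norm_num)
  have hD := (memLp_remainder a hh hX hind hmom).integrable (by norm_num)
  have hcS : Integrable (fun ω => c + linearPart a h μ X ω) μ := (integrable_const c).add hS
  rw [integral_add hcS hD, integral_add (integrable_const c) hS,
    integral_linearPart a hh hX hind hmom, integral_remainder a hh hX hind hmom, integral_const]
  simp only [probReal_univ, one_smul]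
  ring

/-- Pythagoras for the orthogonal decomposition into Hájek projection and remainder. -/
theorem variance_uStat
    (hh : Measurable h) (hX : ∀ i, Measurable (X i)) (hind : iIndepFun X μ)
    (hmom : ∀ t ∈ indexSet n (k + 1), Integrable (fun ω => h (fun j => X (t j) ω) ^ 4) μ ∧
      ∫ ω, h (fun j => X (t j) ω) ^ 4 ∂μ ≤ M) :
    variance (fun ω => uStat a h fun i => X i ω) μ
      = mainVar a h μ X + ∫ ω, remainder a h μ X ω ^ 2 ∂μ := by
  have hS := memLp_linearPart a hh hX hind hmom
  have hD := (memLp_remainder a hh hX hind hmom).mono_exponent (by norm_num : (2 : ENNReal) ≤ 4)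
  have hm : Measurable fun ω => uStat a h fun i => X i ω := by
    unfold uStat
    fun_prop
  rw [variance_eq_integral hm.aemeasurable]
  simp_rw [uStat_sub_integral a hh hX hind hmom]
  have := integral_sq_add_of_orthogonal hS hD (integral_remainder_mul_linearPart a hh hX hind hmom)
    1 1
  simp only [one_mul, one_pow] at this
  rw [this, mainVar_eq_integral_sq a hh hX hind hmom]

theorem integral_sq_remainder_le_rate
    (hh : Measurable h) (hX : ∀ i, Measurable (X i)) (hind : iIndepFun X μ)
    (hmom : ∀ t ∈ indexSet n (k + 1), Integrable (fun ω => h (fun j => X (t j) ω) ^ 4) μ ∧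
      ∫ ω, h (fun j => X (t j) ω) ^ 4 ∂μ ≤ M)
    (hM : 0 < M) (hn : 2 * (k + 1) ≤ n) :
    ∫ ω, remainder a h μ X ω ^ 2 ∂μ ≤
      ((8 + 8 * (k + 1 : ℝ) ^ 2) * (2 ^ (2 * (k + 1)) * ((2 * (k + 1)) ^ 4 : ℕ))) *
        ((n : ℝ) ^ (-2 : ℝ) * avgWeight a 2 2 * M ^ (1 / 2 : ℝ)) := by
  have hM2 : 0 < M ^ (1 / 2 : ℝ) := Real.rpow_pos_of_pos hM _
  have hA := avgWeight_nonneg a 2 2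
  calc _ ≤ _ := integral_sq_remainder_le a hh hX hind hmom hM
    _ ≤ (8 + 8 * (k + 1 : ℝ) ^ 2) * M ^ (1 / 2 : ℝ) *
        (2 ^ (2 * (k + 1)) * ((2 * (k + 1)) ^ 4 : ℕ) * (n : ℝ) ^ (-2 : ℝ)) * avgWeight a 2 2 := by
        have := normalizer_pow_mul_card_le hn (by omega)
          (sq_mul_card_sharingSet_two_two_le n (k + 1))
        gcongr
    _ = _ := by ring

theorem sum_integral_abs_cube_le_rate
    (hh : Measurable h) (hX : ∀ i, Measurable (X i)) (hind : iIndepFun X μ)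
    (hmom : ∀ t ∈ indexSet n (k + 1), Integrable (fun ω => h (fun j => X (t j) ω) ^ 4) μ ∧
      ∫ ω, h (fun j => X (t j) ω) ^ 4 ∂μ ≤ M)
    (hM : 0 < M) (hn : 2 * (k + 1) ≤ n) :
    ∑ i, ∫ ω, |linearTerm a h μ X i ω| ^ 3 ∂μ ≤
      ((k + 1 : ℝ) * 48 * (2 ^ (3 * (k + 1)) * ((3 * (k + 1)) ^ 4 : ℕ))) *
        ((n : ℝ) ^ (-2 : ℝ) * avgWeight a 3 1 * M ^ (3 / 4 : ℝ)) := by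
  have hM2 : 0 < M ^ (3 / 4 : ℝ) := Real.rpow_pos_of_pos hM _
  have hA := avgWeight_nonneg a 3 1
  calc _ ≤ _ := sum_integral_abs_cube_linearTerm_le a hh hX hind hmom hM
    _ ≤ (k + 1 : ℝ) * (48 * M ^ (3 / 4 : ℝ)) *
        (2 ^ (3 * (k + 1)) * ((3 * (k + 1)) ^ 4 : ℕ) * (n : ℝ) ^ (-2 : ℝ)) * avgWeight a 3 1 := by
        have := normalizer_pow_mul_card_le hn (by omega)
          (sq_mul_card_sharingSet_three_one_le n (k + 1))
        gcongr
    _ = _ := by ring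

theorem norm_charFun_linearPart_sub_le
    (hh : Measurable h) (hX : ∀ i, Measurable (X i)) (hind : iIndepFun X μ)
    (hmom : ∀ t ∈ indexSet n (k + 1), Integrable (fun ω => h (fun j => X (t j) ω) ^ 4) μ ∧
      ∫ ω, h (fun j => X (t j) ω) ^ 4 ∂μ ≤ M)
    {V : ℝ} (hV : V = mainVar a h μ X) (hV0 : 0 < V) (s : ℝ) :
    ‖charFun (μ.map fun ω => V ^ (-(1 / 2) : ℝ) * linearPart a h μ X ω) s
      - charFun (gaussianReal 0 1) s‖
      ≤ (4 * |s| ^ 3 + s ^ 4) *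
        (V ^ (-(3 / 2) : ℝ) * ∑ i, ∫ ω, |linearTerm a h μ X i ω| ^ 3 ∂μ) := by
  have hβ0 : 0 < V ^ (-(1 / 2) : ℝ) := Real.rpow_pos_of_pos hV0 _
  have hβ2 : (V ^ (-(1 / 2) : ℝ)) ^ 2 = V⁻¹ := by
    rw [← Real.rpow_natCast, ← Real.rpow_mul hV0.le, ← Real.rpow_neg_one]; norm_num
  have hβ3 : (V ^ (-(1 / 2) : ℝ)) ^ 3 = V ^ (-(3 / 2) : ℝ) := by
    rw [← Real.rpow_natCast, ← Real.rpow_mul hV0.le]; norm_num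
  set β := V ^ (-(1 / 2) : ℝ)
  have hmain := norm_charFun_sum_sub_gaussian_le (μ := μ)
    (f := fun i ω => β * linearTerm a h μ X i ω)
    (fun i => (measurable_linearTerm a hh hX i).const_mul β)
    (fun i => ((memLp_linearTerm a hh hX hind hmom i).mono_exponent (by norm_num)).const_mul β)
    ((iIndepFun_linearTerm a hh hX hind).comp (fun _ x => β * x) fun _ => measurable_const_mul β)
    (fun i => by rw [integral_const_mul, integral_linearTerm a hh hX hind hmom i, mul_zero])
    (by
      simp_rw [mul_pow, integral_const_mul]
      rw [← Finset.mul_sum, ← mainVar_eq_sum a hh hX hind hmom, ← hV, hβ2,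
        inv_mul_cancel₀ hV0.ne']) s
  have hcube : ∀ i, ∫ ω, |β * linearTerm a h μ X i ω| ^ 3 ∂μ
      = V ^ (-(3 / 2) : ℝ) * ∫ ω, |linearTerm a h μ X i ω| ^ 3 ∂μ := fun i => by
    simp_rw [abs_mul, mul_pow, integral_const_mul, abs_of_pos hβ0, hβ3]
  simp_rw [hcube, ← Finset.mul_sum] at hmain
  exact hmain

/-- Triangle inequality through the characteristic function of `V^(-1/2)` times the Hájek
projection: the first summand is the cost of dropping the remainder and changing the scale, the
second is the Lyapunov error. -/
theorem norm_charFun_standardized_uStat_sub_le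
    (hh : Measurable h) (hX : ∀ i, Measurable (X i)) (hind : iIndepFun X μ)
    (hmom : ∀ t ∈ indexSet n (k + 1), Integrable (fun ω => h (fun j => X (t j) ω) ^ 4) μ ∧
      ∫ ω, h (fun j => X (t j) ω) ^ 4 ∂μ ≤ M)
    (hM : 0 < M) (hn : 2 * (k + 1) ≤ n) {V : ℝ}
    (hV : V = mainVar a h μ X) (hV0 : 0 < V) (s : ℝ) :
    ‖charFun (μ.map fun ω => variance (fun ω => uStat a h fun i => X i ω) μ ^ (-(1 / 2) : ℝ) *
        (uStat a h (fun i => X i ω) - ∫ ω', uStat a h (fun i => X i ω') ∂μ)) s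
      - charFun (gaussianReal 0 1) s‖
      ≤ |s| * Real.sqrt (2 - 2 *
          (variance (fun ω => uStat a h fun i => X i ω) μ / V) ^ (-(1 / 2) : ℝ)) +
        (4 * |s| ^ 3 + s ^ 4) *
          (((k + 1 : ℝ) * 48 * (2 ^ (3 * (k + 1)) * ((3 * (k + 1)) ^ 4 : ℕ))) *
            ((n : ℝ) ^ (-2 : ℝ) * V ^ (-(3 / 2) : ℝ) * avgWeight a 3 1 * M ^ (3 / 4 : ℝ))) := by
  have hS := memLp_linearPart a hh hX hind hmom
  have hD := (memLp_remainder a hh hX hind hmom).mono_exponent (by norm_num : (2 : ENNReal) ≤ 4)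
  have hSm : Measurable (linearPart a h μ X) :=
    Finset.measurable_fun_sum _ fun i _ => measurable_linearTerm a hh hX i
  have hDm : Measurable (remainder a h μ X) := measurable_remainder a hh hX
  have hvar := variance_uStat a hh hX hind hmom
  rw [← hV] at hvar
  simp_rw [uStat_sub_integral a hh hX hind hmom]
  set v := variance (fun ω => uStat a h fun i => X i ω) μ
  have h1 := norm_charFun_map_sub_le (μ := μ)
    (f := fun ω => v ^ (-(1 / 2) : ℝ) * (linearPart a h μ X ω + remainder a h μ X ω))
    (g := fun ω => V ^ (-(1 / 2) : ℝ) * linearPart a h μ X ω)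
    ((hSm.add hDm).const_mul _) (hSm.const_mul _)
    (((hS.add hD).integrable (by norm_num)).const_mul _)
    ((hS.integrable (by norm_num)).const_mul _) s
  have h2 := integral_abs_standardized_sub_le hS hD
    (integral_remainder_mul_linearPart a hh hX hind hmom)
    (hV.trans (mainVar_eq_integral_sq a hh hX hind hmom)) hV0 hvar
  have h3 := norm_charFun_linearPart_sub_le a hh hX hind hmom hV hV0 s
  have h4 := sum_integral_abs_cube_le_rate a hh hX hind hmom hM hn
  have hV3 : 0 < V ^ (-(3 / 2) : ℝ) := Real.rpow_pos_of_pos hV0 _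
  refine (norm_sub_le_norm_sub_add_norm_sub _
    (charFun (μ.map fun ω => V ^ (-(1 / 2) : ℝ) * linearPart a h μ X ω) s) _).trans
    (add_le_add (h1.trans (mul_le_mul_of_nonneg_left h2 (abs_nonneg s))) (h3.trans ?_))
  refine mul_le_mul_of_nonneg_left ?_ (by positivity)
  refine (mul_le_mul_of_nonneg_left h4 hV3.le).trans (le_of_eq ?_)
  ring

end

end WeightedU

/-! ### Passage to the limit. -/

theorem mainTheorem1 {𝓧 : Type*} [MeasurableSpace 𝓧]
    {Ω : ℕ → Type*} [∀ n, MeasurableSpace (Ω n)]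
    (μ : (n : ℕ) → Measure (Ω n)) [∀ n, IsProbabilityMeasure (μ n)]
    -- the degree is `m = k + 1`
    (k : ℕ)
    (a : (n : ℕ) → (Fin (k + 1) → Fin n) → ℝ)
    (h : ℕ → (Fin (k + 1) → 𝓧) → ℝ) (hh : ∀ n, Measurable (h n))
    (X : (n : ℕ) → Fin n → Ω n → 𝓧) (hX : ∀ n i, Measurable (X n i))
    (hindep : ∀ n, iIndepFun (X n) (μ n))
    (M : ℕ → ℝ) (hM : ∀ n, 0 < M n)
    (hmoment : ∀ n, ∀ t ∈ WeightedU.indexSet n (k + 1),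
      Integrable (fun ω => h n (fun j => X n (t j) ω) ^ 4) (μ n) ∧
        ∫ ω, h n (fun j => X n (t j) ω) ^ 4 ∂(μ n) ≤ M n)
    (V : ℕ → ℝ) (hV : ∀ n, V n = WeightedU.mainVar (a n) (h n) (μ n) (X n))
    (hVpos : ∀ᶠ n in atTop, 0 < V n)
    (hcond1 : Tendsto (fun n : ℕ => (n : ℝ) ^ (-2 : ℝ) * V n ^ (-1 : ℝ) *
      WeightedU.avgWeight (a n) 2 2 * M n ^ (1 / 2 : ℝ)) atTop (𝓝 0))
    (hcond2 : Tendsto (fun n : ℕ => (n : ℝ) ^ (-2 : ℝ) * V n ^ (-(3 / 2) : ℝ) *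
      WeightedU.avgWeight (a n) 3 1 * M n ^ (3 / 4 : ℝ)) atTop (𝓝 0))
    (U : (n : ℕ) → Ω n → ℝ)
    (hU : ∀ n ω, U n ω = WeightedU.uStat (a n) (h n) (fun i => X n i ω)) :
    Tendsto (fun n => variance (U n) (μ n) / V n) atTop (𝓝 1) ∧
      TendstoInDistribution
        (fun n ω => variance (U n) (μ n) ^ (-(1 / 2) : ℝ) * (U n ω - ∫ ω', U n ω' ∂(μ n)))
        atTop (id : ℝ → ℝ) μ (gaussianReal 0 1) := by
  obtain rfl : U = fun n ω => WeightedU.uStat (a n) (h n) (fun i => X n i ω) :=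
    funext fun n => funext fun ω => hU n ω
  have hlarge : ∀ᶠ n : ℕ in atTop, 2 * (k + 1) ≤ n := eventually_ge_atTop _
  set C₁ : ℝ := (8 + 8 * (k + 1 : ℝ) ^ 2) * (2 ^ (2 * (k + 1)) * ((2 * (k + 1)) ^ 4 : ℕ))
  set C₂ : ℝ := (k + 1 : ℝ) * 48 * (2 ^ (3 * (k + 1)) * ((3 * (k + 1)) ^ 4 : ℕ))
  have hratio : Tendsto (fun n => variance
      (fun ω => WeightedU.uStat (a n) (h n) fun i => X n i ω) (μ n) / V n) atTop (𝓝 1) := by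
    -- The ratio is `1 + E D² / V`: at least one, and at most one plus a constant times the first
    -- vanishing quantity.
    have hupper := (hcond1.const_mul C₁).const_add 1
    simp only [mul_zero, add_zero] at hupper
    refine tendsto_of_tendsto_of_tendsto_of_le_of_le' tendsto_const_nhds hupper ?_ ?_
    · filter_upwards [hVpos] with n hVn
      rw [WeightedU.variance_uStat (a n) (hh n) (hX n) (hindep n) (hmoment n), ← hV n,
        le_div_iff₀ hVn, one_mul]
      exact le_add_of_nonneg_right (integral_nonneg fun ω => sq_nonneg _)
    · filter_upwards [hVpos, hlarge] with n hVn hn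
      rw [WeightedU.variance_uStat (a n) (hh n) (hX n) (hindep n) (hmoment n), ← hV n,
        div_le_iff₀ hVn, Real.rpow_neg_one]
      have hD := WeightedU.integral_sq_remainder_le_rate (a n) (hh n) (hX n) (hindep n)
        (hmoment n) (hM n) hn
      refine (add_le_add_right hD (V n)).trans (le_of_eq ?_)
      have hVinv : (V n)⁻¹ * V n = 1 := inv_mul_cancel₀ hVn.ne'
      linear_combination (-C₁ * ((n : ℝ) ^ (-2 : ℝ) * WeightedU.avgWeight (a n) 2 2 *
        M n ^ (1 / 2 : ℝ))) * hVinv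
  refine ⟨hratio, ?_⟩
  have hmeas : ∀ n, Measurable fun ω => variance
      (fun ω => WeightedU.uStat (a n) (h n) fun i => X n i ω) (μ n) ^ (-(1 / 2) : ℝ) *
        (WeightedU.uStat (a n) (h n) (fun i => X n i ω) -
          ∫ ω', WeightedU.uStat (a n) (h n) (fun i => X n i ω') ∂(μ n)) := fun n => by
    have := hX n
    have := hh n
    unfold WeightedU.uStat
    fun_prop
  refine ⟨fun n => (hmeas n).aemeasurable, aemeasurable_id, ?_⟩
  refine ProbabilityMeasure.tendsto_of_tendsto_charFun fun s => ?_
  simp only [ProbabilityMeasure.coe_mk, Measure.map_id]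
  rw [tendsto_iff_norm_sub_tendsto_zero]
  -- As the variance ratio tends to one, so does its power, and the expression under the root tends
  -- to `2 - 2 = 0`.
  have hroot : Tendsto (fun n => Real.sqrt (2 - 2 * (variance
      (fun ω => WeightedU.uStat (a n) (h n) fun i => X n i ω) (μ n) / V n) ^ (-(1 / 2) : ℝ)))
      atTop (𝓝 0) := by
    have h1 := hratio.rpow_const (p := (-(1 / 2) : ℝ)) (Or.inl one_ne_zero)
    have h2 := ((h1.const_mul 2).const_sub 2).sqrt
    simpa using h2
  have hbound := (hroot.const_mul |s|).add
    ((hcond2.const_mul C₂).const_mul (4 * |s| ^ 3 + s ^ 4))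
  simp only [mul_zero, add_zero] at hbound
  refine squeeze_zero' (Eventually.of_forall fun n => norm_nonneg _) ?_ hbound
  filter_upwards [hVpos, hlarge] with n hVn hn
  exact WeightedU.norm_charFun_standardized_uStat_sub_le (a n) (hh n) (hX n) (hindep n)
    (hmoment n) (hM n) hn (hV n) hVn s
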